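/- Let $\Sigma$ be a finite alphabet with $|\Sigma|\ge 2$, let $n\in\mathbb N$ and $p\in(0,1]$. Let $x=x[1]x[2]\cdots$ be a sequence of independent uniformly random symbols of $\Sigma$; we regard $x[1,n]$ as a string of length $n$. The insertion-deletion channel starts with pointers $i=j=1$ and repeats independent steps: with probability $1-p$ it sets $A^p(i)=j$ and increments $i$ and $j$; with probability $p/2$ it sets $A^p(i)=\bot$ and increments $i$ (deletion); with probability $p/2$ it increments $j$ (insertion). It writes $y[j]=x[i]$ if $A^p(i)=j$, and every other $y[j]$ is an independent uniformly random symbol. The trace $y$ is the output written until the first $n$ symbols of $x$ have been processed, and $|y|$ is its length. The map $A^p$, restricted to $[n]$, is the planted alignment of $x[1,n]$ and $y$. An *alignment* of $x[1,n]$ and $y$ is a map $M:[n]\to[|y|]\cup\{\bot\}$ that is strictly increasing on $\{i: M(i)\ne\bot\}$ and satisfies $x[i]=y[M(i)]$ whenever $M(i)\neq\bot$. Its cost $\mathrm{cost}(M)$ is the number of positions of $x[1,n]$ and of $y$ that are not matched by $M$. For an interval $[a,b]\subseteq[n]$, $\mathrm{cost}_M([a,b])$ is the number of $k\in[a,b]$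 with $M(k)=\bot$ plus the number of unmatched positions of $y$ between the smallest and the largest of the values $M(k)\ne\bot$, $k\in[a,b]$ (the second number is $0$ if there are no such values). Given $\epsilon>0$, put $w=\lfloor \epsilon/p\rfloor$ and $R=\lfloor 2\epsilon/p\rfloor$. Let $\tilde{\mathcal I}$ be the set of the positions $i\in[n]$ at which $A^p$ makes a single isolated edit, which means that all positions of distance at most $\max(R,1)$ from $i$ lie in $[n]$ and that one of the following holds, where every equation includes that the values in it are not $\bot$: * (deletion) $A^p(i+1)=A^p(i-1)+1$, and $A^p(i+j)=A^p(i+j-1)+1$ and $A^p(i-j)=A^p(i-j+1)-1$ for all integers $2\le j\le R$; * (insertion) $A^p(i)=A^p(i-1)+2$, and $A^p(i+j)=A^p(i+j-1)+1$ for all integers $1\le j\le R$, and $A^p(i-j)=A^p(i-j+1)-1$ for all integers $2\le j\le R$. For an alignment $M$ let $\tilde{\mathcal I}_M$ be the set of those $i\in\tilde{\mathcal I}$ for which $\mathrm{cost}_M([i-w,i+w])=1$ and $$A^p(i-w)=\min\{M(k)\ne\bot : k\in[i-w,i+w]\},\qquad A^p(i+w)=\max\{M(k)\neq\bot : k\in[i-w,i+w]\}$$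 (with neither equation satisfied if there is no such $k$). **Lemma.** Let $42\,p\log_2\frac1p\le\epsilon\le\frac16$ and $p\le\delta\le\epsilon$. Then with probability at least $1-4e^{-\epsilon^2p^2n/2}$, every alignment $M$ of $x[1,n]$ and $y$ with $\mathrm{cost}(M)\le(1+\delta)pn$ satisfies $$|\tilde{\mathcal I}_M|\ \ge\ (1-23\epsilon-\delta)\,pn .$$ -/

import Mathlib

open MeasureTheory

namespace IndelChannel

/-! Strings are functions `ℕ → α`; a string of length `n` is given by its values at the positions
`0, …, n - 1` (positions are counted from `0`).  A partial map between positions is a function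
`ℕ → Option ℕ`, with `none` in the role of `⊥`. -/

section Alignments

variable {α : Type*}

/-- `M` is an alignment between `x[0], …, x[n-1]` and `y[0], …, y[m-1]`: it is strictly increasing
on its support, and it only matches equal symbols at positions of the two strings. -/
structure IsAlignment (n m : ℕ) (x y : ℕ → α) (M : ℕ → Option ℕ) : Prop where
  lt_left : ∀ i j, M i = some j → i < n
  lt_right : ∀ i j, M i = some j → j < m
  mono : ∀ i i' j j', i < i' → M i = some j → M i' = some j' → j < j'
  eq_symbol : ∀ i j, M i = some j → x i = y j

open Classical in
/-- The cost of `M` between strings of lengths `n` and `m`: the number of positions in the first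
and in the second string that are not matched by `M`. -/
noncomputable def alignmentCost (n m : ℕ) (M : ℕ → Option ℕ) : ℕ :=
  ((Finset.range n).filter fun i => M i = none).card +
    ((Finset.range m).filter fun j => ∀ i, M i ≠ some j).card

/-- The set of the values `M k ≠ ⊥` with `a ≤ k ≤ b`. -/
def blockValues (M : ℕ → Option ℕ) (a b : ℕ) : Finset ℕ :=
  (Finset.Icc a b).biUnion fun k => (M k).toFinset

/-- The positions of the substring of `y` to which `M` maps `x[a, b]`: all positions from the first
to the last value of `M` on `[a, b]`, and the empty set if no position of `[a, b]` is matched. -/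
noncomputable def blockMapping (M : ℕ → Option ℕ) (a b : ℕ) : Finset ℕ :=
  if h : (blockValues M a b).Nonempty then
    Finset.Icc ((blockValues M a b).min' h) ((blockValues M a b).max' h)
  else ∅

open Classical in
/-- The cost of `M` on the substring `x[a, b]`: the number of unmatched positions of `x[a, b]` plus
the number of unmatched positions in the substring of `y` to which `M` maps it. -/
noncomputable def blockCost (M : ℕ → Option ℕ) (a b : ℕ) : ℕ :=
  ((Finset.Icc a b).filter fun k => M k = none).card +
    ((blockMapping M a b).filter fun j => ∀ k, M k ≠ some j).card

end Alignments

section Channel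

/-- One step of the channel. -/
inductive EditOp where
  | keep : EditOp
  | del : EditOp
  | ins : EditOp
  deriving DecidableEq

instance : Fintype EditOp :=
  ⟨{.keep, .del, .ins}, fun o => by cases o <;> decide⟩

instance : MeasurableSpace EditOp := ⊤

/-- The probabilities of the three operations in one step. -/
noncomputable def opWeight (p : ℝ) : EditOp → ENNReal
  | .keep => ENNReal.ofReal (1 - p)
  | .del => ENNReal.ofReal (p / 2)
  | .ins => ENNReal.ofReal (p / 2)

theorem sum_opWeight (p : ℝ) (hp : p ∈ Set.Icc (0 : ℝ) 1) : ∑ o, opWeight p o = 1 := by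
  have hu : (Finset.univ : Finset EditOp) = {.keep, .del, .ins} := rfl
  have h1 : 0 ≤ 1 - p := by linarith [hp.2]
  have h2 : 0 ≤ p / 2 := by linarith [hp.1]
  rw [hu, Finset.sum_insert (by decide), Finset.sum_insert (by decide), Finset.sum_singleton]
  simp only [opWeight]
  rw [← ENNReal.ofReal_add h2 h2, ← ENNReal.ofReal_add h1 (by linarith), ← ENNReal.ofReal_one]
  congr 1
  ring

/-- The law of one step: keep with probability `1 - p`, delete with probability `p / 2`, insert with
probability `p / 2`. -/
noncomputable def opPMF (p : ℝ) (hp : p ∈ Set.Icc (0 : ℝ) 1) : PMF EditOp :=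
  PMF.ofFintype (opWeight p) (sum_opWeight p hp)

/-- The pair (number of input symbols read, number of output symbols written) after `t` steps; in
other words the pair of pointers to the current position in the input and in the output. -/
def pointers (ops : ℕ → EditOp) : ℕ → ℕ × ℕ
  | 0 => (0, 0)
  | t + 1 =>
    match ops t with
    | .keep => ((pointers ops t).1 + 1, (pointers ops t).2 + 1)
    | .del => ((pointers ops t).1 + 1, (pointers ops t).2)
    | .ins => ((pointers ops t).1, (pointers ops t).2 + 1)

open Classical in
/-- The planted alignment: `i` is mapped to `j` if some step keeps the input position `i` and writes
it to the output position `j`, and to `⊥` if there is no such step. -/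
noncomputable def planted (ops : ℕ → EditOp) (i : ℕ) : Option ℕ :=
  if h : ∃ t, ops t = .keep ∧ (pointers ops t).1 = i then some (pointers ops (Nat.find h)).2
  else none

open Classical in
/-- The length of the output at the moment when the first `n` input symbols have been read.  (That
moment exists almost surely, for a noise rate less than `1`.) -/
noncomputable def traceLength (ops : ℕ → EditOp) (n : ℕ) : ℕ :=
  if h : ∃ t, (pointers ops t).1 = n then (pointers ops (Nat.find h)).2 else 0

variable {α : Type*}

open Classical in
/-- The output string: a position which is matched by the planted alignment carries the matched
symbol of `x`, any other position `j` carries the fresh symbol `c j`. -/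
noncomputable def trace (ops : ℕ → EditOp) (x c : ℕ → α) (j : ℕ) : α :=
  if h : ∃ i, planted ops i = some j then x h.choose else c j

/-- The joint law of the steps of the channel, of the uniformly random input string and of the
uniformly random symbols for the insertions; all the coordinates are independent. -/
noncomputable def channelMeasure (α : Type*) [Fintype α] [Nonempty α] [MeasurableSpace α]
    (p : ℝ) (hp : p ∈ Set.Icc (0 : ℝ) 1) :
    Measure ((ℕ → EditOp) × (ℕ → α) × (ℕ → α)) :=
  (Measure.infinitePi fun _ : ℕ => (opPMF p hp).toMeasure).prod
    ((Measure.infinitePi fun _ : ℕ => (PMF.uniformOfFintype α).toMeasure).prod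
      (Measure.infinitePi fun _ : ℕ => (PMF.uniformOfFintype α).toMeasure))

end Channel

section Isolated

/-- `A l = A k + d`, where in particular neither side is `⊥`. -/
def StepBy (A : ℕ → Option ℕ) (k l d : ℕ) : Prop :=
  ∃ a, A k = some a ∧ A l = some (a + d)

/-- The map `A` makes a single deletion, at position `i`, within distance `R` of `i`. -/
def IsolatedDel (A : ℕ → Option ℕ) (R i : ℕ) : Prop :=
  StepBy A (i - 1) (i + 1) 1 ∧
    ∀ j, 2 ≤ j → j ≤ R → StepBy A (i + j - 1) (i + j) 1 ∧ StepBy A (i - j) (i - j + 1) 1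

/-- The map `A` makes a single insertion, directly in front of position `i`, within distance `R`
of `i`. -/
def IsolatedIns (A : ℕ → Option ℕ) (R i : ℕ) : Prop :=
  StepBy A (i - 1) i 2 ∧
    (∀ j, 1 ≤ j → j ≤ R → StepBy A (i + j - 1) (i + j) 1) ∧
    ∀ j, 2 ≤ j → j ≤ R → StepBy A (i - j) (i - j + 1) 1

open Classical in
/-- The positions `i` of a string of length `n` around which `A` makes a single edit operation,
namely at `i`, and no other one within distance `2ε/p`.  All the positions which the conditions
mention (those at distance at most `2ε/p`, and the neighbours of `i`) have to lie in the string. -/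
noncomputable def isolated (ε p : ℝ) (n : ℕ) (A : ℕ → Option ℕ) : Finset ℕ :=
  (Finset.range n).filter fun i =>
    (1 ≤ i ∧ i + 1 < n) ∧ (⌊2 * ε / p⌋₊ ≤ i ∧ i + ⌊2 * ε / p⌋₊ < n) ∧
      (IsolatedDel A ⌊2 * ε / p⌋₊ i ∨ IsolatedIns A ⌊2 * ε / p⌋₊ i)

/-- `A` and `M` agree on the boundaries of the block `[a, b]`: the values `A a` and `A b` are the
minimum and the maximum of the values `M k ≠ ⊥` with `a ≤ k ≤ b` (which is false if there are no
such values). -/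
def AgreeOnBoundary (A M : ℕ → Option ℕ) (a b : ℕ) : Prop :=
  (∃ u, A a = some u ∧ IsLeast (blockValues M a b : Set ℕ) u) ∧
    ∃ v, A b = some v ∧ IsGreatest (blockValues M a b : Set ℕ) v

open Classical in
/-- The isolated edit positions `i` such that `A` and `M` agree on the boundaries of the block of
all positions at distance at most `ε/p` from `i`, and `M` has cost exactly `1` on this block. -/
noncomputable def agreeing (ε p : ℝ) (n : ℕ) (A M : ℕ → Option ℕ) : Finset ℕ :=
  (isolated ε p n A).filter fun i =>
    AgreeOnBoundary A M (i - ⌊ε / p⌋₊) (i + ⌊ε / p⌋₊) ∧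
      blockCost M (i - ⌊ε / p⌋₊) (i + ⌊ε / p⌋₊) = 1

end Isolated

end IndelChannel

namespace IndelChannel

/-! ### Resampling one coordinate of a product measure -/

section Resampling

/-! Write `w = ⌊ε/p⌋`, `R = ⌊2ε/p⌋`, `h = ⌊w/2⌋`. Two isolated edits are more than `R ≥ 2w` apart,
so the blocks `[i-w, i+w]` around them are disjoint. On such a block the planted alignment follows
one diagonal before `i` and a different one after `i`. Suppose `M` costs at most 1 there. If `M`
meets both diagonals, the change of diagonal uses up this cost, so `M` follows the planted alignment
to both ends of the block and the edit is agreeing. Otherwise `M` misses one diagonal entirely and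
has, on that side, an error-free run of `h` pairs none of which is planted: the edit is diverging.
All other blocks cost at least 2. Summing over blocks, `2|isolated| ≤ |agreeing| + cost(M) +
2|diverging|` (`two_mul_card_isolated_le`).

It remains to bound two counts. There are fewer than `εpn` diverging edits: for `B` prescribed runs
the `Bh` unplanted pairs all match with probability at most `|Σ|^(-Bh)` (`measure_matching_le`),
because the last pair always involves a symbol on which the earlier pairs do not depend. The lower
bound on `ε` gives `2^(-h) ≤ 2p^21`, which beats the number of choices of starting positions
(`choose_mul_choose_mul_le`).

There are at least `(1-8ε)pn` isolated edits: an Azuma inequality with weights depending on the past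
(`measure_predictable_sum_le`) is applied to a martingale that minorises this count
(`sum_isolationWeight_le`).

Together these give `2(1-8ε) - (1+δ) - 2ε = 1-18ε-δ`, within the claim. Each of the two bad events
has probability at most `exp(-ε²p²n/2)`. -/

theorem measurePreserving_update_infinitePi {ι β : Type*} [DecidableEq ι] [MeasurableSpace β]
    (P : ι → Measure β) [∀ i, IsProbabilityMeasure (P i)] (v : ι) :
    MeasurePreserving (fun z : (ι → β) × β => Function.update z.1 v z.2)
      ((Measure.infinitePi P).prod (P v)) (Measure.infinitePi P) := by
  have hm : Measurable (fun z : (ι → β) × β => Function.update z.1 v z.2) := by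
    refine measurable_pi_lambda _ fun i => ?_
    by_cases h : i = v
    · subst h; simpa using measurable_snd
    · simp only [Function.update_of_ne h]
      exact (measurable_pi_apply i).comp measurable_fst
  refine ⟨hm, Measure.eq_infinitePi _ fun s t ht => ?_⟩
  have hpi : MeasurableSet (Set.pi (s : Set ι) t) :=
    MeasurableSet.pi s.countable_toSet fun i _ => ht i
  rw [Measure.map_apply hm hpi]
  by_cases hv : v ∈ s
  · have : (fun z : (ι → β) × β => Function.update z.1 v z.2) ⁻¹' (Set.pi (s : Set ι) t) =
        (Set.pi ((s.erase v : Finset ι) : Set ι) t) ×ˢ t v := by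
      ext ⟨z, a⟩
      simp only [Set.mem_preimage, Set.mem_pi, Set.mem_prod, Finset.coe_erase, Finset.mem_coe,
        Set.mem_sdiff, Set.mem_singleton_iff]
      constructor
      · intro h
        refine ⟨fun i hi => ?_, by simpa using h v hv⟩
        simpa [Function.update_of_ne hi.2] using h i hi.1
      · rintro ⟨h1, h2⟩ i hi
        by_cases h : i = v
        · subst h; simpa using h2
        · simpa [Function.update_of_ne h] using h1 i ⟨hi, h⟩
    rw [this, Measure.prod_prod, Measure.infinitePi_pi _ fun i _ => ht i,
      Finset.prod_erase_mul _ _ hv]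
  · have : (fun z : (ι → β) × β => Function.update z.1 v z.2) ⁻¹' (Set.pi (s : Set ι) t) =
        (Set.pi (s : Set ι) t) ×ˢ Set.univ := by
      ext ⟨z, a⟩
      simp only [Set.mem_preimage, Set.mem_pi, Set.mem_prod, Finset.mem_coe, Set.mem_univ,
        and_true]
      refine forall₂_congr fun i hi => ?_
      have hiv : i ≠ v := by rintro rfl; exact hv hi
      rw [Function.update_of_ne hiv]
    rw [this, Measure.prod_prod, Measure.infinitePi_pi _ fun i _ => ht i, measure_univ, mul_one]

variable {α : Type*} [Fintype α] [Nonempty α] [MeasurableSpace α]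

/-- The law of the input string and of the symbols for the insertions. -/
noncomputable def wordMeasure (α : Type*) [Fintype α] [Nonempty α] [MeasurableSpace α] :
    Measure ((ℕ → α) × (ℕ → α)) :=
  (Measure.infinitePi fun _ : ℕ => (PMF.uniformOfFintype α).toMeasure).prod
    (Measure.infinitePi fun _ : ℕ => (PMF.uniformOfFintype α).toMeasure)

instance : IsProbabilityMeasure (wordMeasure α) := by
  unfold wordMeasure; infer_instance

theorem measurePreserving_update_snd (v : ℕ) :
    MeasurePreserving
      (fun z : ((ℕ → α) × (ℕ → α)) × α => (z.1.1, Function.update z.1.2 v z.2))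
      ((wordMeasure α).prod (PMF.uniformOfFintype α).toMeasure) (wordMeasure α) := by
  have h1 := (MeasurePreserving.id
    (Measure.infinitePi fun _ : ℕ => (PMF.uniformOfFintype α).toMeasure)).prod
      (measurePreserving_update_infinitePi
        (fun _ : ℕ => (PMF.uniformOfFintype α).toMeasure) v)
  exact h1.comp (measurePreserving_prodAssoc _ _ _)

theorem measurePreserving_update_fst (v : ℕ) :
    MeasurePreserving
      (fun z : ((ℕ → α) × (ℕ → α)) × α => (Function.update z.1.1 v z.2, z.1.2))
      ((wordMeasure α).prod (PMF.uniformOfFintype α).toMeasure) (wordMeasure α) := by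
  have hs : MeasurePreserving Prod.swap (wordMeasure α) (wordMeasure α) :=
    Measure.measurePreserving_swap
  exact hs.comp ((measurePreserving_update_snd v).comp
    (hs.prod (MeasurePreserving.id (PMF.uniformOfFintype α).toMeasure)))

/-- Fubini over the resampled symbol: for each `z ∈ E` exactly one of its values produces the match.
This takes the place of conditioning on the other coordinates. -/
theorem measure_inter_eq_of_resample [DiscreteMeasurableSpace α] {Ω : Type*} [MeasurableSpace Ω]
    {ν : Measure Ω} [SFinite ν] {r : Ω × α → Ω}
    (hr : MeasurePreserving r (ν.prod (PMF.uniformOfFintype α).toMeasure) ν)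
    {E : Set Ω} (hE : MeasurableSet E) {X Y : Ω → α} (hX : Measurable X) (hY : Measurable Y)
    (hEr : ∀ z a, r (z, a) ∈ E ↔ z ∈ E) (hXr : ∀ z a, X (r (z, a)) = a)
    (hYr : ∀ z a, Y (r (z, a)) = Y z) :
    ν (E ∩ {z | X z = Y z}) = (Fintype.card α : ENNReal)⁻¹ * ν E := by
  have hXY : MeasurableSet (E ∩ {z | X z = Y z}) := hE.inter (measurableSet_eq_fun hX hY)
  rw [← hr.measure_preimage hXY.nullMeasurableSet, Measure.prod_apply (hr.measurable hXY),
    ← lintegral_indicator_const hE]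
  refine lintegral_congr fun z => ?_
  by_cases hz : z ∈ E
  · have : Prod.mk z ⁻¹' (r ⁻¹' (E ∩ {z | X z = Y z})) = {Y z} := by
      ext a; simp [hEr, hXr, hYr, hz]
    rw [this, Set.indicator_of_mem hz, PMF.toMeasure_uniformOfFintype_apply _ (.singleton _)]
    simp
  · have : Prod.mk z ⁻¹' (r ⁻¹' (E ∩ {z | X z = Y z})) = ∅ := by
      ext a; simp [hEr, hz]
    rw [this, Set.indicator_of_notMem hz, measure_empty]

end Resampling

/-! ### Probability that unplanted pairs match -/

section Matching

variable {α : Type*}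

/-- A partial map that is strictly increasing on its support. -/
def PartialStrictMono (A : ℕ → Option ℕ) : Prop :=
  ∀ i i' j j', i < i' → A i = some j → A i' = some j' → j < j'

theorem PartialStrictMono.lt_of_lt {A : ℕ → Option ℕ} (hA : PartialStrictMono A)
    {i i' j j' : ℕ} (h : A i = some j) (h' : A i' = some j') (hj : j < j') : i < i' := by
  rcases lt_trichotomy i i' with h1 | h1 | h1
  · exact h1
  · subst h1; rw [h] at h'; simp at h'; omega
  · have := hA _ _ _ _ h1 h' h; omega

theorem PartialStrictMono.eq_of_eq {A : ℕ → Option ℕ} (hA : PartialStrictMono A)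
    {i i' j : ℕ} (h : A i = some j) (h' : A i' = some j) : i = i' := by
  rcases lt_trichotomy i i' with h1 | h1 | h1
  · have := hA _ _ _ _ h1 h h'; omega
  · exact h1
  · have := hA _ _ _ _ h1 h' h; omega

open Classical in
/-- The string which carries `x i` at position `A i`, and `c j` at all positions `j` outside of the
range of `A`. -/
noncomputable def outputWord (A : ℕ → Option ℕ) (x c : ℕ → α) (j : ℕ) : α :=
  if h : ∃ i, A i = some j then x h.choose else c j

theorem outputWord_of_eq {A : ℕ → Option ℕ} (hA : PartialStrictMono A) {x c : ℕ → α} {i j : ℕ}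
    (h : A i = some j) : outputWord A x c j = x i := by
  have hex : ∃ i, A i = some j := ⟨i, h⟩
  rw [outputWord, dif_pos hex, hA.eq_of_eq hex.choose_spec h]

theorem outputWord_of_ne {A : ℕ → Option ℕ} {x c : ℕ → α} {j : ℕ}
    (h : ∀ i, A i ≠ some j) : outputWord A x c j = c j := by
  rw [outputWord, dif_neg (by simpa using h)]

theorem measurable_outputWord [MeasurableSpace α] (A : ℕ → Option ℕ) (j : ℕ) :
    Measurable fun z : (ℕ → α) × (ℕ → α) => outputWord A z.1 z.2 j := by
  unfold outputWord
  split_ifs with h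
  · exact (measurable_pi_apply _).comp measurable_fst
  · exact (measurable_pi_apply _).comp measurable_snd

variable [Fintype α] [Nonempty α] [MeasurableSpace α] [DiscreteMeasurableSpace α]

/-- Remove the largest `k`. The symbol at `g k` is either a fresh `c (g k)` or some `x i` with `i ≠
k`. By monotonicity of `g` and `A`, earlier pairs read `x` only before `max k i` and `c` only before
`g k`, so one symbol of the last pair can be resampled. -/
theorem measure_matching_le {A : ℕ → Option ℕ} (hA : PartialStrictMono A) (g : ℕ → ℕ)
    (K : Finset ℕ) (hg : StrictMonoOn g K) (hne : ∀ k ∈ K, A k ≠ some (g k)) :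
    wordMeasure α {z | ∀ k ∈ K, z.1 k = outputWord A z.1 z.2 (g k)} ≤
      (Fintype.card α : ENNReal)⁻¹ ^ K.card := by
  induction K using Finset.induction_on_max with
  | empty => simp
  | insert k K hk ih =>
    have hkK : k ∉ K := fun h => lt_irrefl _ (hk k h)
    set E : Set ((ℕ → α) × (ℕ → α)) := {z | ∀ k ∈ K, z.1 k = outputWord A z.1 z.2 (g k)} with hE
    have hEm : MeasurableSet E := by
      have : E = ⋂ k ∈ K, {z | z.1 k = outputWord A z.1 z.2 (g k)} := by ext; simp [hE]
      rw [this]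
      exact Finset.measurableSet_biInter _ fun k _ => measurableSet_eq_fun
        ((measurable_pi_apply _).comp measurable_fst) (measurable_outputWord A _)
    have hgk : ∀ l ∈ K, g l < g k := fun l hl =>
      hg (by simp [hl]) (by simp) (hk l hl)
    have key : wordMeasure α (E ∩ {z | z.1 k = outputWord A z.1 z.2 (g k)}) =
        (Fintype.card α : ENNReal)⁻¹ * wordMeasure α E := by
      by_cases hj : ∃ i, A i = some (g k)
      · obtain ⟨i, hi⟩ := hj
        have hik : i ≠ k := fun h => hne k (by simp) (h ▸ hi)
        have hfresh : ∀ v, k ≤ v → i ≤ v → ∀ (z : (ℕ → α) × (ℕ → α)) (a : α),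
            (Function.update z.1 v a, z.2) ∈ E ↔ z ∈ E := by
          intro v hkv hiv z a
          refine forall₂_congr fun l hl => ?_
          have h1 : Function.update z.1 v a l = z.1 l :=
            Function.update_of_ne (by have := hk l hl; omega) _ _
          have h2 : outputWord A (Function.update z.1 v a) z.2 (g l) =
              outputWord A z.1 z.2 (g l) := by
            by_cases hl' : ∃ i', A i' = some (g l)
            · obtain ⟨i', hi'⟩ := hl'
              have := hA.lt_of_lt hi' hi (hgk l hl)
              rw [outputWord_of_eq hA hi', outputWord_of_eq hA hi',
                Function.update_of_ne (by omega)]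
            · push Not at hl'
              rw [outputWord_of_ne hl', outputWord_of_ne hl']
          simp only [h1, h2]
        simp only [outputWord_of_eq hA hi]
        -- The later of the positions `i` and `k` is the one to resample.
        rcases lt_or_gt_of_ne hik with hlt | hlt
        · refine measure_inter_eq_of_resample (X := fun z => z.1 k) (Y := fun z => z.1 i)
            (measurePreserving_update_fst k) hEm
            ((measurable_pi_apply _).comp measurable_fst)
            ((measurable_pi_apply _).comp measurable_fst)
            (hfresh k le_rfl hlt.le) (by simp) (fun z a => ?_)
          simp [Function.update_of_ne hik]
        · have := measure_inter_eq_of_resample (X := fun z => z.1 i) (Y := fun z => z.1 k)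
            (measurePreserving_update_fst i) hEm
            ((measurable_pi_apply _).comp measurable_fst)
            ((measurable_pi_apply _).comp measurable_fst)
            (hfresh i hlt.le le_rfl) (by simp)
            (fun z a => by simp [Function.update_of_ne hik.symm])
          simpa only [eq_comm] using this
      · push Not at hj
        simp only [outputWord_of_ne hj]
        have := measure_inter_eq_of_resample (X := fun z => z.2 (g k)) (Y := fun z => z.1 k)
            (measurePreserving_update_snd (g k)) hEm
            ((measurable_pi_apply _).comp measurable_snd)
            ((measurable_pi_apply _).comp measurable_fst)
            (fun z a => ?_) (by simp) (by simp)
        · simpa only [eq_comm] using this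
        · refine forall₂_congr fun l hl => ?_
          have h2 : outputWord A z.1 (Function.update z.2 (g k) a) (g l) =
              outputWord A z.1 z.2 (g l) := by
            by_cases hl' : ∃ i', A i' = some (g l)
            · obtain ⟨i', hi'⟩ := hl'
              rw [outputWord_of_eq hA hi', outputWord_of_eq hA hi']
            · push Not at hl'
              rw [outputWord_of_ne hl', outputWord_of_ne hl',
                Function.update_of_ne (hgk l hl).ne]
          simp only [h2]
    have hset : {z : (ℕ → α) × (ℕ → α) |
        ∀ l ∈ insert k K, z.1 l = outputWord A z.1 z.2 (g l)} =
        E ∩ {z | z.1 k = outputWord A z.1 z.2 (g k)} := by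
      ext z; simp [hE, and_comm]
    rw [hset, key, Finset.card_insert_of_notMem hkK, pow_succ']
    gcongr
    exact ih (hg.mono (by simp)) fun l hl => hne l (by simp [hl])

end Matching

/-! ### Azuma–Hoeffding with predictable weights -/

section Concentration

open ProbabilityTheory

instance : DiscreteMeasurableSpace EditOp := ⟨fun _ => trivial⟩

/-- The law of the steps of the channel. -/
noncomputable def opsMeasure (p : ℝ) (hp : p ∈ Set.Icc (0 : ℝ) 1) : Measure (ℕ → EditOp) :=
  Measure.infinitePi fun _ : ℕ => (opPMF p hp).toMeasure

instance (p : ℝ) (hp : p ∈ Set.Icc (0 : ℝ) 1) : IsProbabilityMeasure (opsMeasure p hp) := by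
  unfold opsMeasure; infer_instance

/-- The indicator of an edit. -/
noncomputable def editIndicator (o : EditOp) : ℝ := if o = .keep then 0 else 1

theorem integral_editIndicator (p : ℝ) (hp : p ∈ Set.Icc (0 : ℝ) 1) :
    ∫ o, editIndicator o ∂(opPMF p hp).toMeasure = p := by
  have hu : (Finset.univ : Finset EditOp) = {.keep, .del, .ins} := rfl
  have h2 : 0 ≤ p / 2 := by linarith [hp.1]
  rw [PMF.integral_eq_sum, hu, Finset.sum_insert (by decide), Finset.sum_insert (by decide),
    Finset.sum_singleton]
  simp [editIndicator, opPMF, opWeight, ENNReal.toReal_ofReal h2]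

/-- Hoeffding's lemma for a variable with values in `[0, 1]` and mean `p`. -/
theorem lintegral_exp_editIndicator_le (p : ℝ) (hp : p ∈ Set.Icc (0 : ℝ) 1) (s : ℝ) :
    ∫⁻ o, ENNReal.ofReal (Real.exp (s * (editIndicator o - p))) ∂(opPMF p hp).toMeasure ≤
      ENNReal.ofReal (Real.exp (s ^ 2 / 8)) := by
  have hsub := hasSubgaussianMGF_of_mem_Icc (μ := (opPMF p hp).toMeasure) (X := editIndicator)
    (a := 0) (b := 1) (Measurable.of_discrete).aemeasurable
    (Filter.Eventually.of_forall fun o => by unfold editIndicator; split_ifs <;> simp)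
  rw [integral_editIndicator] at hsub
  rw [← ofReal_integral_eq_lintegral_ofReal (hsub.integrable_exp_mul s)
    (Filter.Eventually.of_forall fun o => (Real.exp_pos _).le)]
  refine ENNReal.ofReal_le_ofReal ((hsub.mgf_le s).trans_eq ?_)
  congr 1
  norm_num
  ring

variable {W : ℕ → (ℕ → EditOp) → ℝ}

theorem measurable_exp_predictable_sum (hWm : ∀ t, Measurable (W t)) (p c : ℝ) (n : ℕ) :
    Measurable fun z : ℕ → EditOp => ENNReal.ofReal (Real.exp
      (c * ∑ t ∈ Finset.range n, W t z * (editIndicator (z t) - p))) := by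
  refine ENNReal.measurable_ofReal.comp (Real.measurable_exp.comp
    (Measurable.const_mul (Finset.measurable_sum _ fun t _ => (hWm t).mul
      (Measurable.sub_const ?_ _)) _))
  exact (Measurable.of_discrete (f := editIndicator)).comp (measurable_pi_apply t)

/-- Resampling step `n` integrates out the last factor with its weight frozen, since `W t` ignores
the steps from `t` on. -/
theorem lintegral_exp_predictable_sum_le (p : ℝ) (hp : p ∈ Set.Icc (0 : ℝ) 1)
    (hWm : ∀ t, Measurable (W t)) (hW : ∀ t s z a, t ≤ s → W t (Function.update z s a) = W t z)
    (hWb : ∀ t z, |W t z| ≤ 2) (c : ℝ) (n : ℕ) :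
    ∫⁻ z, ENNReal.ofReal (Real.exp (c * ∑ t ∈ Finset.range n, W t z * (editIndicator (z t) - p)))
      ∂(opsMeasure p hp) ≤ ENNReal.ofReal (Real.exp (c ^ 2 / 2 * n)) := by
  induction n with
  | zero => simp
  | succ n ih =>
    have hmeas := fun n => measurable_exp_predictable_sum hWm p c n
    have hup := measurePreserving_update_infinitePi
      (fun _ : ℕ => (opPMF p hp).toMeasure) n
    change MeasurePreserving _ ((opsMeasure p hp).prod _) (opsMeasure p hp) at hup
    rw [← hup.lintegral_comp (hmeas (n + 1))]
    refine (lintegral_prod _ ((hmeas (n + 1)).comp hup.measurable).aemeasurable).le.trans ?_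
    have hle : ∀ z : ℕ → EditOp, ∫⁻ a, ENNReal.ofReal (Real.exp (c * ∑ t ∈ Finset.range (n + 1),
        W t (Function.update z n a) * (editIndicator (Function.update z n a t) - p)))
          ∂(opPMF p hp).toMeasure ≤
        ENNReal.ofReal (Real.exp (c * ∑ t ∈ Finset.range n, W t z * (editIndicator (z t) - p))) *
          ENNReal.ofReal (Real.exp (c ^ 2 / 2)) := by
      intro z
      have heq : ∀ a, ENNReal.ofReal (Real.exp (c * ∑ t ∈ Finset.range (n + 1),
          W t (Function.update z n a) * (editIndicator (Function.update z n a t) - p))) =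
          ENNReal.ofReal (Real.exp
            (c * ∑ t ∈ Finset.range n, W t z * (editIndicator (z t) - p))) *
          ENNReal.ofReal (Real.exp (c * W n z * (editIndicator a - p))) := by
        intro a
        have hpast : ∀ t ∈ Finset.range n,
            W t (Function.update z n a) * (editIndicator (Function.update z n a t) - p) =
              W t z * (editIndicator (z t) - p) := by
          intro t ht
          have htn := Finset.mem_range.1 ht
          rw [hW t n z a htn.le, Function.update_of_ne htn.ne]
        rw [← ENNReal.ofReal_mul (Real.exp_pos _).le, ← Real.exp_add, Finset.sum_range_succ,
          Finset.sum_congr rfl hpast, hW n n z a le_rfl, Function.update_self, mul_add,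
          ← mul_assoc c (W n z)]
      simp only [heq]
      rw [lintegral_const_mul _ Measurable.of_discrete]
      gcongr
      refine (lintegral_exp_editIndicator_le p hp _).trans
        (ENNReal.ofReal_le_ofReal (Real.exp_le_exp.2 ?_))
      -- Hoeffding's exponent `(c W)² / 8` becomes at most `c² / 2`.
      have h4 : W n z ^ 2 ≤ 4 := by
        rw [← sq_abs]; nlinarith [hWb n z, abs_nonneg (W n z)]
      rw [mul_pow]
      nlinarith [sq_nonneg c]
    refine (lintegral_mono hle).trans ?_
    rw [lintegral_mul_const _ (hmeas n)]
    refine (mul_le_mul_left ih _).trans_eq ?_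
    rw [← ENNReal.ofReal_mul (Real.exp_pos _).le, ← Real.exp_add]
    push_cast
    ring_nf

/-- The Azuma–Hoeffding inequality for the edits, with weights which depend on the past. -/
theorem measure_predictable_sum_le (p : ℝ) (hp : p ∈ Set.Icc (0 : ℝ) 1)
    (hWm : ∀ t, Measurable (W t)) (hW : ∀ t s z a, t ≤ s → W t (Function.update z s a) = W t z)
    (hWb : ∀ t z, |W t z| ≤ 2) (n : ℕ) {d : ℝ} (hd : 0 ≤ d) :
    opsMeasure p hp {z | ∑ t ∈ Finset.range n, W t z * (editIndicator (z t) - p) ≤ -(d * n)} ≤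
      ENNReal.ofReal (Real.exp (-(d ^ 2 * n) / 2)) := by
  -- Markov's inequality at parameter `-d`: the exponent is `d²n/2 - d²n = -d²n/2`.
  have h1 := mul_meas_ge_le_lintegral₀ (μ := opsMeasure p hp)
    (measurable_exp_predictable_sum hWm p (-d) n).aemeasurable
    (ENNReal.ofReal (Real.exp (d ^ 2 * n)))
  have h2 := h1.trans (lintegral_exp_predictable_sum_le p hp hWm hW hWb (-d) n)
  have hsub : {z : ℕ → EditOp |
      ∑ t ∈ Finset.range n, W t z * (editIndicator (z t) - p) ≤ -(d * n)} ⊆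
      {z | ENNReal.ofReal (Real.exp (d ^ 2 * n)) ≤ ENNReal.ofReal (Real.exp
        (-d * ∑ t ∈ Finset.range n, W t z * (editIndicator (z t) - p)))} := by
    intro z hz
    refine ENNReal.ofReal_le_ofReal (Real.exp_le_exp.2 ?_)
    have := mul_le_mul_of_nonneg_left (Set.mem_ofPred.1 hz) hd
    nlinarith
  refine (measure_mono hsub).trans ?_
  rw [mul_comm, ← ENNReal.le_div_iff_mul_le (Or.inl (by simp [Real.exp_pos]))
    (Or.inl ENNReal.ofReal_ne_top)] at h2
  refine h2.trans_eq ?_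
  rw [← ENNReal.ofReal_div_of_pos (Real.exp_pos _), ← Real.exp_sub]
  ring_nf

end Concentration

/-! ### From isolated channel steps to isolated positions -/

section Pointers

variable {ops : ℕ → EditOp}

theorem pointers_succ_of_keep {t : ℕ} (h : ops t = .keep) :
    pointers ops (t + 1) = ((pointers ops t).1 + 1, (pointers ops t).2 + 1) := by
  simp [pointers, h]

theorem pointers_succ_of_del {t : ℕ} (h : ops t = .del) :
    pointers ops (t + 1) = ((pointers ops t).1 + 1, (pointers ops t).2) := by
  simp [pointers, h]

theorem pointers_succ_of_ins {t : ℕ} (h : ops t = .ins) :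
    pointers ops (t + 1) = ((pointers ops t).1, (pointers ops t).2 + 1) := by
  simp [pointers, h]

theorem pointers_mono (ops : ℕ → EditOp) : Monotone (pointers ops) := by
  refine monotone_nat_of_le_succ fun t => ?_
  cases h : ops t
  · rw [pointers_succ_of_keep h]; exact ⟨by simp, by simp⟩
  · rw [pointers_succ_of_del h]; exact ⟨by simp, by simp⟩
  · rw [pointers_succ_of_ins h]; exact ⟨by simp, by simp⟩

theorem pointers_fst_le (ops : ℕ → EditOp) (t : ℕ) : (pointers ops t).1 ≤ t := by
  induction t with
  | zero => simp [pointers]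
  | succ t ih =>
    cases h : ops t
    · rw [pointers_succ_of_keep h]; simpa using ih
    · rw [pointers_succ_of_del h]; simpa using ih
    · rw [pointers_succ_of_ins h]; exact ih.trans (Nat.le_succ t)

theorem pointers_lt_of_keep {t t' : ℕ} (h : ops t = .keep) (ht : t < t') :
    (pointers ops t).1 < (pointers ops t').1 ∧ (pointers ops t).2 < (pointers ops t').2 := by
  have h1 := pointers_mono ops (Nat.succ_le_of_lt ht)
  rw [Nat.succ_eq_add_one, pointers_succ_of_keep h] at h1
  exact ⟨Nat.lt_of_succ_le h1.1, Nat.lt_of_succ_le h1.2⟩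

theorem planted_eq_some_iff {i j : ℕ} :
    planted ops i = some j ↔ ∃ t, ops t = .keep ∧ pointers ops t = (i, j) := by
  classical
  constructor
  · intro h
    unfold planted at h
    split_ifs at h with hex
    obtain ⟨h1, h2⟩ := Nat.find_spec hex
    exact ⟨_, h1, Prod.ext h2 (by simpa using h)⟩
  · rintro ⟨t, ht, hp⟩
    have hex : ∃ t, ops t = .keep ∧ (pointers ops t).1 = i := ⟨t, ht, by rw [hp]⟩
    have hfind : Nat.find hex = t := by
      obtain ⟨h1, h2⟩ := Nat.find_spec hex
      have h3 : (pointers ops t).1 = i := by rw [hp]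
      rcases lt_trichotomy (Nat.find hex) t with h | h | h
      · have := (pointers_lt_of_keep h1 h).1; omega
      · exact h
      · have := (pointers_lt_of_keep ht h).1; omega
    unfold planted
    rw [dif_pos hex, hfind, hp]

theorem partialStrictMono_planted (ops : ℕ → EditOp) : PartialStrictMono (planted ops) := by
  intro i i' j j' hi h h'
  obtain ⟨t, ht, hp⟩ := planted_eq_some_iff.1 h
  obtain ⟨t', ht', hp'⟩ := planted_eq_some_iff.1 h'
  rcases lt_trichotomy t t' with hlt | heq | hlt
  · have := (pointers_lt_of_keep ht hlt).2
    rwa [hp, hp'] at this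
  · subst heq; rw [hp] at hp'; simp at hp'; omega
  · have := (pointers_lt_of_keep ht' hlt).1
    rw [hp, hp'] at this; simp at this; omega

theorem pointers_add_of_keep {t i j d : ℕ} (hp : pointers ops t = (i, j))
    (h : ∀ m < d, ops (t + m) = .keep) : pointers ops (t + d) = (i + d, j + d) := by
  induction d with
  | zero => simpa using hp
  | succ d ih =>
    rw [← add_assoc, pointers_succ_of_keep (h d (Nat.lt_succ_self d)),
      ih fun m hm => h m (hm.trans (Nat.lt_succ_self d))]
    rfl

theorem planted_add_of_keep {t i j d : ℕ} (hp : pointers ops t = (i, j))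
    (h : ∀ m < d, ops (t + m) = .keep) {m : ℕ} (hm : m < d) :
    planted ops (i + m) = some (j + m) :=
  planted_eq_some_iff.2
    ⟨t + m, h m hm, pointers_add_of_keep hp fun m' hm' => h m' (hm'.trans hm)⟩

/-- There is an edit among the last `L` steps before step `t`. -/
def RecentEdit (L : ℕ) (ops : ℕ → EditOp) (t : ℕ) : Prop :=
  ∃ s, s < t ∧ t ≤ s + L ∧ ops s ≠ .keep

open Classical in
/-- The edits among the first `n` steps. -/
noncomputable def editSteps (ops : ℕ → EditOp) (n : ℕ) : Finset ℕ :=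
  (Finset.range n).filter fun t => ops t ≠ .keep

open Classical in
/-- The steps `t` among the first `n` steps such that step `t` is the only edit among the steps at
distance at most `L` from `t`. -/
noncomputable def isolatedSteps (L : ℕ) (ops : ℕ → EditOp) (n : ℕ) : Finset ℕ :=
  (editSteps ops n).filter fun t => L ≤ t ∧ t + L < n ∧
    ∀ s, s ≠ t → t ≤ s + L → s ≤ t + L → ops s = .keep

theorem exists_planted_of_mem_isolatedSteps {L n t : ℕ} (ht : t ∈ isolatedSteps L ops n) :
    ∃ i j, (pointers ops t).1 = i + L ∧ (∀ m < L, planted ops (i + m) = some (j + m)) ∧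
      ((∀ m < L, planted ops (i + L + 1 + m) = some (j + L + m)) ∨
        ∀ m < L, planted ops (i + L + m) = some (j + L + 1 + m)) := by
  classical
  simp only [isolatedSteps, editSteps, Finset.mem_filter, Finset.mem_range] at ht
  obtain ⟨⟨-, hedit⟩, hL, -, hkeep⟩ := ht
  obtain ⟨s, rfl⟩ := Nat.exists_eq_add_of_le' hL
  have hs : pointers ops s = ((pointers ops s).1, (pointers ops s).2) := rfl
  set i := (pointers ops s).1
  set j := (pointers ops s).2
  have hbefore : ∀ m < L, ops (s + m) = .keep := fun m hm =>
    hkeep _ (by omega) (by omega) (by omega)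
  have hafter : ∀ m < L, ops (s + L + 1 + m) = .keep := fun m hm =>
    hkeep _ (by omega) (by omega) (by omega)
  have hmid := pointers_add_of_keep hs hbefore
  refine ⟨i, j, by rw [hmid], fun m hm => planted_add_of_keep hs hbefore hm, ?_⟩
  cases h : ops (s + L)
  · exact absurd h hedit
  · left
    have h1 := pointers_succ_of_del h
    rw [hmid] at h1
    exact fun m hm => planted_add_of_keep h1 hafter hm
  · right
    have h1 := pointers_succ_of_ins h
    rw [hmid] at h1
    exact fun m hm => planted_add_of_keep h1 hafter hm

/-- The window is `R + 1` because after an insertion in front of `i` the `R + 1` positions `i, …, i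
+ R` must be kept. The input pointer never exceeds the time, so a window inside the first `n` steps
gives positions inside the string. -/
theorem pointers_mem_isolated {ε p : ℝ} {n t : ℕ} (hR : 1 ≤ ⌊2 * ε / p⌋₊)
    (ht : t ∈ isolatedSteps (⌊2 * ε / p⌋₊ + 1) ops n) :
    (pointers ops t).1 ∈ isolated ε p n (planted ops) := by
  classical
  obtain ⟨i, j, hi, hb, ha⟩ := exists_planted_of_mem_isolatedSteps ht
  simp only [isolatedSteps, editSteps, Finset.mem_filter, Finset.mem_range] at ht
  have hle := pointers_fst_le ops t
  rw [isolated, Finset.mem_filter, Finset.mem_range]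
  rw [hi] at hle ⊢
  generalize ⌊2 * ε / p⌋₊ = R at *
  refine ⟨by omega, by omega, by omega, ?_⟩
  rcases ha with ha | ha
  · left
    refine ⟨⟨j + R, ?_, ?_⟩, fun m h2 hm => ⟨⟨j + (R + 1) + (m - 2), ?_, ?_⟩,
      ⟨j + (R + 1 - m), ?_, ?_⟩⟩⟩
    · rw [← hb R (by omega)]; congr 1
    · exact ha 0 (by omega)
    · rw [← ha (m - 2) (by omega)]; congr 1; omega
    · rw [show j + (R + 1) + (m - 2) + 1 = j + (R + 1) + (m - 1) by omega,
        ← ha (m - 1) (by omega)]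
      congr 1; omega
    · rw [← hb _ (by omega)]; congr 1; omega
    · rw [add_assoc, ← hb _ (by omega)]; congr 1; omega
  · right
    refine ⟨⟨j + R, ?_, ?_⟩, fun m h2 hm => ⟨j + (R + 1) + 1 + (m - 1), ?_, ?_⟩,
      fun m h2 hm => ⟨j + (R + 1 - m), ?_, ?_⟩⟩
    · rw [← hb R (by omega)]; congr 1
    · exact ha 0 (by omega)
    · rw [← ha (m - 1) (by omega)]; congr 1; omega
    · rw [add_assoc _ (m - 1), ← ha _ (by omega)]
      congr 1; omega
    · rw [← hb _ (by omega)]; congr 1; omega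
    · rw [add_assoc, ← hb _ (by omega)]; congr 1; omega

/-- An insertion leaves the input pointer in place, so injectivity needs the kept step that follows
every isolated edit. -/
theorem card_isolatedSteps_le {ε p : ℝ} {n : ℕ} (hR : 1 ≤ ⌊2 * ε / p⌋₊) :
    (isolatedSteps (⌊2 * ε / p⌋₊ + 1) ops n).card ≤ (isolated ε p n (planted ops)).card := by
  classical
  refine Finset.card_le_card_of_injOn (fun t => (pointers ops t).1)
    (fun t ht => pointers_mem_isolated hR ht) ?_
  have hlt : ∀ t ∈ isolatedSteps (⌊2 * ε / p⌋₊ + 1) ops n,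
      ∀ t' ∈ isolatedSteps (⌊2 * ε / p⌋₊ + 1) ops n, t < t' →
        (pointers ops t).1 < (pointers ops t').1 := by
    intro t ht t' ht' hlt
    simp only [isolatedSteps, editSteps, Finset.mem_filter, Finset.mem_range] at ht ht'
    have hk : ops (t + 1) = .keep := ht.2.2.2 _ (by omega) (by omega) (by omega)
    have hne : t' ≠ t + 1 := by rintro rfl; exact ht'.1.2 hk
    have h1 := (pointers_lt_of_keep hk (show t + 1 < t' by omega)).1
    have h2 := (pointers_mono ops (Nat.le_succ t)).1
    exact h2.trans_lt h1
  intro t ht t' ht' heq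
  rcases lt_trichotomy t t' with h | h | h
  · have := hlt t ht t' ht' h; simp only at heq; omega
  · exact h
  · have := hlt t' ht' t ht h; simp only at heq; omega

end Pointers

/-! ### Lower bound for the number of isolated edits -/

section Counting

variable {ops : ℕ → EditOp}

open Classical in
-- Send an edit to the next edit. This map is injective, and its values have a recent edit. It
-- trades a condition on the future for one on the past, as predictable weights require.
theorem card_filter_editSteps_next_le (L n : ℕ) :
    ((editSteps ops n).filter fun t => ∃ s, t < s ∧ s ≤ t + L ∧ s < n ∧ ops s ≠ .keep).card ≤
      ((editSteps ops n).filter fun t => RecentEdit L ops t).card := by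
  have hnext : ∀ t, (∃ s, t < s ∧ s ≤ t + L ∧ s < n ∧ ops s ≠ .keep) →
      ∃ s, (t < s ∧ s ≤ t + L ∧ s < n ∧ ops s ≠ .keep) ∧
        ∀ r, t < r → ops r ≠ .keep → s ≤ r := by
    intro t ht
    refine ⟨Nat.find ht, Nat.find_spec ht, fun r hr hrk => ?_⟩
    by_contra! hlt
    have hs := Nat.find_spec ht
    exact Nat.find_min ht hlt ⟨hr, by omega, by omega, hrk⟩
  choose! f hf hmin using hnext
  refine Finset.card_le_card_of_injOn f ?_ ?_
  · intro t ht
    simp only [editSteps, Finset.coe_filter, Finset.mem_filter, Finset.mem_range,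
      Set.mem_ofPred_eq] at ht ⊢
    have := hf t ht.2
    exact ⟨this.2.2, t, this.1, this.2.1, ht.1.2⟩
  · intro t ht t' ht' heq
    simp only [editSteps, Finset.coe_filter, Finset.mem_filter, Finset.mem_range,
      Set.mem_ofPred_eq] at ht ht'
    have h1 := hf t ht.2
    have h2 := hf t' ht'.2
    rcases lt_trichotomy t t' with h | h | h
    · have := hmin t ht.2 t' h ht'.1.2; omega
    · exact h
    · have := hmin t' ht'.2 t h ht.1.2; omega

open Classical in
-- A non-isolated edit has another edit shortly before it or shortly after it, or lies within `L` of
-- an end; the two ends contribute `2 * L`.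
theorem card_editSteps_le (L n : ℕ) :
    (editSteps ops n).card ≤ (isolatedSteps L ops n).card +
      2 * ((editSteps ops n).filter fun t => RecentEdit L ops t).card + 2 * L := by
  have hsub : editSteps ops n ⊆ isolatedSteps L ops n ∪
      ((editSteps ops n).filter fun t => RecentEdit L ops t) ∪
      ((editSteps ops n).filter fun t => ∃ s, t < s ∧ s ≤ t + L ∧ s < n ∧ ops s ≠ .keep) ∪
      Finset.range L ∪ Finset.Ico (n - L) n := by
    intro t ht
    simp only [Finset.mem_union, Finset.mem_filter, isolatedSteps, Finset.mem_range,
      Finset.mem_Ico, ht, true_and]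
    have htn : t < n := by
      simp only [editSteps, Finset.mem_filter, Finset.mem_range] at ht; exact ht.1
    by_contra! hcon
    obtain ⟨⟨⟨⟨h1, h2⟩, h3⟩, h4⟩, h5⟩ := hcon
    obtain ⟨s, hs1, hs2, hs3, hs4⟩ := h1 h4 (by by_contra! h; have := h5 (by omega); omega)
    rcases lt_or_gt_of_ne hs1 with h | h
    · exact h2 ⟨s, h, hs2, hs4⟩
    · exact hs4 (h3 s h hs3 (by by_contra! h; have := h5 (by omega); omega))
  have h1 := Finset.card_le_card hsub
  have h2 := card_filter_editSteps_next_le (ops := ops) L n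
  have h3 : (Finset.Ico (n - L) n).card ≤ L := by rw [Nat.card_Ico]; omega
  have h4 := Finset.card_range L
  refine h1.trans ((Finset.card_union_le _ _).trans ?_)
  refine (Nat.add_le_add_right (Finset.card_union_le _ _) _).trans ?_
  refine (Nat.add_le_add_right (Nat.add_le_add_right (Finset.card_union_le _ _) _) _).trans ?_
  refine (Nat.add_le_add_right (Nat.add_le_add_right
    (Nat.add_le_add_right (Finset.card_union_le _ _) _) _) _).trans ?_
  omega

open Classical in
theorem card_recentEdit_le (L n : ℕ) :
    ((Finset.range n).filter fun t => RecentEdit L ops t).card ≤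
      (editSteps ops n).card * L := by
  have hsub : ((Finset.range n).filter fun t => RecentEdit L ops t) ⊆
      (editSteps ops n).biUnion fun s => Finset.Ioc s (s + L) := by
    intro t ht
    simp only [Finset.mem_filter, Finset.mem_range] at ht
    obtain ⟨htn, s, h1, h2, h3⟩ := ht
    simp only [Finset.mem_biUnion, editSteps, Finset.mem_filter, Finset.mem_range, Finset.mem_Ioc]
    exact ⟨s, ⟨by omega, h3⟩, h1, h2⟩
  exact (Finset.card_le_card hsub).trans (Finset.card_biUnion_le_card_mul _ _ _ (by simp))

open Classical in
/-- The weights of the martingale which bounds the number of isolated edits. -/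
noncomputable def isolationWeight (p : ℝ) (L t : ℕ) (ops : ℕ → EditOp) : ℝ :=
  1 - 2 * p * L - 2 * if RecentEdit L ops t then 1 else 0

/-- With `E` edits, `E'` of them having a recent edit, and `T` times having one, the weighted sum is
`(1-2pL)E - 2E' - (1-2pL)pn + 2pT`. The summand `-2pL` in the weight is there to absorb the
compensator `2pT`, as `T ≤ LE`; what remains is `E - 2E' ≤ |isolatedSteps| + 2L`. -/
theorem sum_isolationWeight_le {p : ℝ} (hp : 0 ≤ p) (L n : ℕ) :
    (1 - 2 * p * L) * p * n +
        ∑ t ∈ Finset.range n, isolationWeight p L t ops * (editIndicator (ops t) - p) - 2 * L ≤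
      ((isolatedSteps L ops n).card : ℝ) := by
  classical
  have h1 : ((editSteps ops n).card : ℝ) ≤ (isolatedSteps L ops n).card +
      2 * ((editSteps ops n).filter fun t => RecentEdit L ops t).card + 2 * L := by
    exact_mod_cast card_editSteps_le (ops := ops) L n
  have h2 : (((Finset.range n).filter fun t => RecentEdit L ops t).card : ℝ) ≤
      (editSteps ops n).card * L := by
    exact_mod_cast card_recentEdit_le (ops := ops) L n
  have h3 : ∑ t ∈ Finset.range n, editIndicator (ops t) = (editSteps ops n).card := by
    rw [editSteps, Finset.card_filter]
    push_cast
    refine Finset.sum_congr rfl fun t _ => ?_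
    unfold editIndicator
    split_ifs <;> simp_all
  have h4 : ∑ t ∈ Finset.range n, (if RecentEdit L ops t then (1 : ℝ) else 0) *
      editIndicator (ops t) = ((editSteps ops n).filter fun t => RecentEdit L ops t).card := by
    rw [editSteps, Finset.filter_filter, Finset.card_filter]
    push_cast
    refine Finset.sum_congr rfl fun t _ => ?_
    unfold editIndicator
    split_ifs <;> simp_all
  have h5 : ∑ t ∈ Finset.range n, (if RecentEdit L ops t then (1 : ℝ) else 0) =
      ((Finset.range n).filter fun t => RecentEdit L ops t).card := by
    rw [Finset.card_filter]; push_cast; rfl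
  have h6 : ∑ t ∈ Finset.range n, isolationWeight p L t ops * (editIndicator (ops t) - p) =
      (1 - 2 * p * L) * ∑ t ∈ Finset.range n, editIndicator (ops t) -
      2 * ∑ t ∈ Finset.range n, (if RecentEdit L ops t then (1 : ℝ) else 0) *
        editIndicator (ops t) - (1 - 2 * p * L) * p * n +
      2 * p * ∑ t ∈ Finset.range n, (if RecentEdit L ops t then (1 : ℝ) else 0) := by
    simp only [Finset.mul_sum, isolationWeight]
    have : (1 - 2 * p * L) * p * n = ∑ t ∈ Finset.range n, (1 - 2 * p * L) * p := by
      simp; ring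
    rw [this, ← Finset.sum_sub_distrib, ← Finset.sum_sub_distrib, ← Finset.sum_add_distrib]
    refine Finset.sum_congr rfl fun t _ => ?_
    ring
  rw [h6, h3, h4, h5]
  have h7 := mul_le_mul_of_nonneg_left h2 (by linarith : 0 ≤ 2 * p)
  nlinarith

theorem measurable_isolationWeight (p : ℝ) (L t : ℕ) : Measurable (isolationWeight p L t) := by
  classical
  have hset : MeasurableSet {ops : ℕ → EditOp | RecentEdit L ops t} := by
    have : {ops : ℕ → EditOp | RecentEdit L ops t} =
        ⋃ s, ⋃ (_ : s < t), ⋃ (_ : t ≤ s + L), (fun ops : ℕ → EditOp => ops s) ⁻¹' {.keep}ᶜ := by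
      ext ops
      simp only [RecentEdit, Set.mem_ofPred_eq, Set.mem_iUnion, Set.mem_preimage,
        Set.mem_compl_iff, Set.mem_singleton_iff, exists_prop, ne_eq]
    rw [this]
    exact .iUnion fun s => .iUnion fun _ => .iUnion fun _ => measurable_pi_apply s trivial
  exact measurable_const.sub ((Measurable.ite hset measurable_const measurable_const).const_mul _)

theorem isolationWeight_update (p : ℝ) (L t s : ℕ) (ops : ℕ → EditOp) (a : EditOp) (h : t ≤ s) :
    isolationWeight p L t (Function.update ops s a) = isolationWeight p L t ops := by
  have : RecentEdit L (Function.update ops s a) t ↔ RecentEdit L ops t := by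
    refine exists_congr fun r => and_congr_right fun hr => and_congr_right fun _ => ?_
    rw [Function.update_of_ne (by omega)]
  unfold isolationWeight
  by_cases hr : RecentEdit L ops t
  · rw [if_pos hr, if_pos (this.2 hr)]
  · rw [if_neg hr, if_neg (mt this.1 hr)]

theorem abs_isolationWeight_le {p : ℝ} (hp : 0 ≤ p) {L : ℕ} (hL : 2 * p * L ≤ 1) (t : ℕ)
    (ops : ℕ → EditOp) : |isolationWeight p L t ops| ≤ 2 := by
  have : 0 ≤ p * L := by positivity
  unfold isolationWeight
  rw [abs_le]
  split_ifs <;> constructor <;> linarith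

end Counting

/-! ### Costs of blocks -/

section BlockCost

variable {M : ℕ → Option ℕ}

theorem IsAlignment.partialStrictMono {α : Type*} {n m : ℕ} {x y : ℕ → α}
    (h : IsAlignment n m x y M) : PartialStrictMono M := h.mono

theorem mem_blockValues {a b u : ℕ} :
    u ∈ blockValues M a b ↔ ∃ k, (a ≤ k ∧ k ≤ b) ∧ M k = some u := by
  simp [blockValues]

theorem mem_blockMapping {a b j : ℕ} :
    j ∈ blockMapping M a b ↔ (∃ k u, (a ≤ k ∧ k ≤ b) ∧ M k = some u ∧ u ≤ j) ∧
      ∃ k v, (a ≤ k ∧ k ≤ b) ∧ M k = some v ∧ j ≤ v := by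
  unfold blockMapping
  split_ifs with h
  · rw [Finset.mem_Icc]
    constructor
    · rintro ⟨h1, h2⟩
      obtain ⟨k, hk, hu⟩ := mem_blockValues.1 ((blockValues M a b).min'_mem h)
      obtain ⟨l, hl, hv⟩ := mem_blockValues.1 ((blockValues M a b).max'_mem h)
      exact ⟨⟨k, _, hk, hu, h1⟩, ⟨l, _, hl, hv, h2⟩⟩
    · rintro ⟨⟨k, u, hk, hu, huj⟩, ⟨l, v, hl, hv, hvj⟩⟩
      exact ⟨(Finset.min'_le _ _ (mem_blockValues.2 ⟨k, hk, hu⟩)).trans huj,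
        hvj.trans (Finset.le_max' _ _ (mem_blockValues.2 ⟨l, hl, hv⟩))⟩
  · simp only [Finset.notMem_empty, false_iff]
    rintro ⟨⟨k, u, hk, hu, huj⟩, -⟩
    exact h ⟨u, mem_blockValues.2 ⟨k, hk, hu⟩⟩

open Classical in
/-- The unmatched positions of `x[a, b]`. -/
noncomputable def unmatchedLeft (M : ℕ → Option ℕ) (a b : ℕ) : Finset ℕ :=
  (Finset.Icc a b).filter fun k => M k = none

open Classical in
/-- The unmatched positions of the substring to which `M` maps `x[a, b]`. -/
noncomputable def unmatchedRight (M : ℕ → Option ℕ) (a b : ℕ) : Finset ℕ :=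
  (blockMapping M a b).filter fun j => ∀ k, M k ≠ some j

theorem blockCost_eq (M : ℕ → Option ℕ) (a b : ℕ) :
    blockCost M a b = (unmatchedLeft M a b).card + (unmatchedRight M a b).card := rfl

theorem mem_unmatchedLeft {a b k : ℕ} :
    k ∈ unmatchedLeft M a b ↔ (a ≤ k ∧ k ≤ b) ∧ M k = none := by
  classical
  simp [unmatchedLeft]

theorem mem_unmatchedRight {a b j : ℕ} :
    j ∈ unmatchedRight M a b ↔ (∃ k u, (a ≤ k ∧ k ≤ b) ∧ M k = some u ∧ u < j) ∧
      (∃ k v, (a ≤ k ∧ k ≤ b) ∧ M k = some v ∧ j < v) ∧ ∀ k, M k ≠ some j := by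
  classical
  rw [unmatchedRight, Finset.mem_filter, mem_blockMapping]
  constructor
  · rintro ⟨⟨⟨k, u, hk, hu, huj⟩, ⟨l, v, hl, hv, hvj⟩⟩, h⟩
    exact ⟨⟨k, u, hk, hu, lt_of_le_of_ne huj fun e => h k (e ▸ hu)⟩,
      ⟨l, v, hl, hv, lt_of_le_of_ne hvj fun e => h l (e ▸ hv)⟩, h⟩
  · rintro ⟨⟨k, u, hk, hu, huj⟩, ⟨l, v, hl, hv, hvj⟩, h⟩
    exact ⟨⟨⟨k, u, hk, hu, huj.le⟩, ⟨l, v, hl, hv, hvj.le⟩⟩, h⟩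

theorem unmatchedLeft_mono {a b a' b' : ℕ} (ha : a ≤ a') (hb : b' ≤ b) :
    unmatchedLeft M a' b' ⊆ unmatchedLeft M a b := by
  intro k
  simp only [mem_unmatchedLeft]
  rintro ⟨h1, h2⟩
  exact ⟨⟨by omega, by omega⟩, h2⟩

theorem unmatchedRight_mono {a b a' b' : ℕ} (ha : a ≤ a') (hb : b' ≤ b) :
    unmatchedRight M a' b' ⊆ unmatchedRight M a b := by
  intro k
  simp only [mem_unmatchedRight]
  rintro ⟨⟨k, u, hk, hu⟩, ⟨l, v, hl, hv⟩, h⟩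
  exact ⟨⟨k, u, ⟨by omega, by omega⟩, hu⟩, ⟨l, v, ⟨by omega, by omega⟩, hv⟩, h⟩

/-- Unmatched positions lie strictly between matched values, so the blocks may even share an
endpoint. -/
theorem PartialStrictMono.disjoint_unmatchedRight (hM : PartialStrictMono M) {a b a' b' : ℕ}
    (h : b ≤ a') : Disjoint (unmatchedRight M a b) (unmatchedRight M a' b') := by
  rw [Finset.disjoint_left]
  intro j h1 h2
  obtain ⟨-, ⟨k, v, hk, hv, hjv⟩, -⟩ := mem_unmatchedRight.1 h1
  obtain ⟨⟨l, u, hl, hu, huj⟩, -, -⟩ := mem_unmatchedRight.1 h2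
  have := hM.lt_of_lt hu hv (huj.trans hjv)
  omega

theorem disjoint_unmatchedLeft {a b a' b' : ℕ} (h : b < a' ∨ b = a' ∧ M b ≠ none) :
    Disjoint (unmatchedLeft M a b) (unmatchedLeft M a' b') := by
  rw [Finset.disjoint_left]
  intro j h1 h2
  rw [mem_unmatchedLeft] at h1 h2
  rcases h with h | ⟨rfl, h⟩
  · omega
  · exact h ((by omega : j = b) ▸ h1.2)

theorem PartialStrictMono.blockCost_add_le (hM : PartialStrictMono M) {a b c d c' d' : ℕ}
    (ha : a ≤ c) (hd : d ≤ b) (hc' : a ≤ c') (hb : d' ≤ b) (h : d < c' ∨ d = c' ∧ M d ≠ none) :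
    blockCost M c d + blockCost M c' d' ≤ blockCost M a b := by
  classical
  have h1 := Finset.card_le_card (Finset.union_subset
    (unmatchedLeft_mono (M := M) ha hd) (unmatchedLeft_mono (M := M) hc' hb))
  have h2 := Finset.card_le_card (Finset.union_subset
    (unmatchedRight_mono (M := M) ha hd) (unmatchedRight_mono (M := M) hc' hb))
  rw [Finset.card_union_of_disjoint (disjoint_unmatchedLeft h)] at h1
  rw [Finset.card_union_of_disjoint (hM.disjoint_unmatchedRight (by omega))] at h2
  simp only [blockCost_eq]
  omega

theorem IsAlignment.sum_blockCost_le {α ι : Type*} {n m : ℕ} {x y : ℕ → α}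
    (hM : IsAlignment n m x y M) (I : Finset ι) (c d : ι → ℕ) (hd : ∀ i ∈ I, d i < n)
    (hdisj : ∀ i ∈ I, ∀ j ∈ I, i ≠ j → d i < c j ∨ d j < c i) :
    ∑ i ∈ I, blockCost M (c i) (d i) ≤ alignmentCost n m M := by
  classical
  have h1 : ∑ i ∈ I, (unmatchedLeft M (c i) (d i)).card ≤
      ((Finset.range n).filter fun i => M i = none).card := by
    rw [← Finset.card_biUnion]
    · refine Finset.card_le_card (Finset.biUnion_subset.2 fun i hi k hk => ?_)
      rw [mem_unmatchedLeft] at hk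
      have := hd i hi
      simp only [Finset.mem_filter, Finset.mem_range]
      exact ⟨by omega, hk.2⟩
    · intro i hi j hj hij
      rcases hdisj i hi j hj hij with h | h
      · exact disjoint_unmatchedLeft (.inl h)
      · exact (disjoint_unmatchedLeft (.inl h)).symm
  have h2 : ∑ i ∈ I, (unmatchedRight M (c i) (d i)).card ≤
      ((Finset.range m).filter fun j => ∀ i, M i ≠ some j).card := by
    rw [← Finset.card_biUnion]
    · refine Finset.card_le_card (Finset.biUnion_subset.2 fun i hi k hk => ?_)
      obtain ⟨-, ⟨l, v, -, hv, hkv⟩, h⟩ := mem_unmatchedRight.1 hk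
      have := hM.lt_right _ _ hv
      simp only [Finset.mem_filter, Finset.mem_range]
      exact ⟨by omega, h⟩
    · intro i hi j hj hij
      rcases hdisj i hi j hj hij with h | h
      · exact hM.partialStrictMono.disjoint_unmatchedRight h.le
      · exact (hM.partialStrictMono.disjoint_unmatchedRight h.le).symm
  simp only [blockCost_eq, Finset.sum_add_distrib]
  unfold alignmentCost
  convert add_le_add h1 h2

theorem IsAlignment.le_add_alignmentCost {α : Type*} {n m : ℕ} {x y : ℕ → α}
    (hM : IsAlignment n m x y M) : m ≤ n + alignmentCost n m M := by
  classical
  have h1 : ((Finset.range m).filter fun j => ¬ ∀ i, M i ≠ some j).card ≤ n := by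
    have hex : ∀ j, ¬ (∀ i, M i ≠ some j) → ∃ i, M i = some j := fun j h => by
      push Not at h; exact h
    choose! f hf using hex
    rw [← Finset.card_range n]
    refine Finset.card_le_card_of_injOn f ?_ ?_
    · intro j hj
      rw [Finset.mem_coe, Finset.mem_filter] at hj
      simpa using hM.lt_left _ _ (hf j hj.2)
    · intro j hj j' hj' h
      rw [Finset.mem_coe, Finset.mem_filter] at hj hj'
      have h1 := hf j hj.2
      rw [h, hf j' hj'.2] at h1
      simpa using h1.symm
  have h2 := Finset.card_filter_add_card_filter_not (s := Finset.range m)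
    (fun j => ∀ i, M i ≠ some j)
  rw [Finset.card_range] at h2
  have h3 : ((Finset.range m).filter fun j => ∀ i, M i ≠ some j).card ≤ alignmentCost n m M := by
    unfold alignmentCost
    convert Nat.le_add_left _ _
  omega

/-- Every position is matched, and a jump of more than 1 between neighbours would leave an unmatched
output position inside the block. -/
theorem PartialStrictMono.exists_run_of_blockCost_eq_zero (hM : PartialStrictMono M) {c d : ℕ}
    (h : blockCost M c (c + d) = 0) : ∃ u, ∀ t ≤ d, M (c + t) = some (u + t) := by
  rw [blockCost_eq, Nat.add_eq_zero_iff, Finset.card_eq_zero, Finset.card_eq_zero] at h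
  have hmatch : ∀ t ≤ d, ∃ u, M (c + t) = some u := by
    intro t ht
    rw [← Option.ne_none_iff_exists']
    intro hnone
    have : c + t ∈ unmatchedLeft M c (c + d) :=
      mem_unmatchedLeft.2 ⟨⟨by omega, by omega⟩, hnone⟩
    simp [h.1] at this
  obtain ⟨u, hu⟩ := hmatch 0 (Nat.zero_le d)
  refine ⟨u, fun t => ?_⟩
  induction t with
  | zero => exact fun _ => hu
  | succ t ih =>
    intro ht
    have h1 := ih (by omega)
    obtain ⟨v, hv⟩ := hmatch (t + 1) ht
    have h2 := hM _ _ _ _ (by omega : c + t < c + (t + 1)) h1 hv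
    rcases Nat.lt_or_ge (u + (t + 1)) v with h3 | h3
    · exfalso
      have : u + (t + 1) ∈ unmatchedRight M c (c + d) := by
        refine mem_unmatchedRight.2 ⟨⟨c + t, _, ⟨by omega, by omega⟩, h1, by omega⟩,
          ⟨c + (t + 1), _, ⟨by omega, by omega⟩, hv, h3⟩, fun k hk => ?_⟩
        have h4 := hM.lt_of_lt h1 hk (by omega)
        have h5 := hM.lt_of_lt hk hv h3
        omega
      simp [h.2] at this
    · rw [hv]; congr 1; omega

end BlockCost

/-! ### An alignment near an isolated edit -/

section IsolatedBlocks

variable {A M : ℕ → Option ℕ}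

theorem StepBy.eq_some_add {k l d a : ℕ} (h : StepBy A k l d) (hk : A k = some a) :
    A l = some (a + d) := by
  obtain ⟨b, hb, hb'⟩ := h
  rw [hk] at hb
  simp only [Option.some.injEq] at hb
  rw [hb', hb]

/-- The condition `v ≠ u + w + 1` says that the two runs lie on different diagonals. -/
theorem exists_runs_of_isolated {R i w : ℕ} (h : IsolatedDel A R i ∨ IsolatedIns A R i)
    (hw : 1 ≤ w) (hwR : w ≤ R) (hRi : R ≤ i) :
    ∃ u v, (∀ m < w, A (i - w + m) = some (u + m)) ∧
      (∀ m < w, A (i - w + w + 1 + m) = some (v + m)) ∧ v ≠ u + w + 1 := by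
  have hback : ∀ a, A (i - 1) = some a →
      (∀ j, 2 ≤ j → j ≤ R → StepBy A (i - j) (i - j + 1) 1) →
      ∀ j, 1 ≤ j → j ≤ R → ∃ c, A (i - j) = some c ∧ c + (j - 1) = a := by
    intro a ha hstep j hj1
    induction j, hj1 using Nat.le_induction with
    | base => exact fun _ => ⟨a, ha, by simp⟩
    | succ j hj ih =>
      intro hjR
      obtain ⟨c, hc, hca⟩ := ih (by omega)
      obtain ⟨b, hb, hb'⟩ := hstep (j + 1) (by omega) hjR
      rw [show i - (j + 1) + 1 = i - j by omega, hc] at hb'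
      simp only [Option.some.injEq] at hb'
      exact ⟨b, hb, by omega⟩
  have hleft : ∀ a, A (i - 1) = some a →
      (∀ j, 2 ≤ j → j ≤ R → StepBy A (i - j) (i - j + 1) 1) →
      ∃ u, u + (w - 1) = a ∧ ∀ m < w, A (i - w + m) = some (u + m) := by
    intro a ha hstep
    obtain ⟨u, -, hu⟩ := hback a ha hstep w hw hwR
    refine ⟨u, hu, fun m hm => ?_⟩
    obtain ⟨c, hc, hca⟩ := hback a ha hstep (w - m) (by omega) (by omega)
    rw [show i - w + m = i - (w - m) by omega, hc]
    congr 1; omega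
  have hright : ∀ v, A (i + 1) = some v →
      (∀ j, 2 ≤ j → j ≤ R → StepBy A (i + j - 1) (i + j) 1) →
      ∀ m < w, A (i - w + w + 1 + m) = some (v + m) := by
    intro v hv hstep m
    rw [show i - w + w = i by omega]
    induction m with
    | zero => exact fun _ => hv
    | succ m ih =>
      intro hm
      have := (hstep (m + 2) (by omega) (by omega))
      rw [show i + (m + 2) - 1 = i + 1 + m by omega, show i + (m + 2) = i + 1 + (m + 1) by omega]
        at this
      exact this.eq_some_add (ih (by omega))
  rcases h with ⟨⟨a, ha, ha'⟩, h2⟩ | ⟨⟨a, ha, ha'⟩, h2, h3⟩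
  · obtain ⟨u, hu, hu'⟩ := hleft a ha fun j hj hjR => (h2 j hj hjR).2
    exact ⟨u, a + 1, hu', hright _ ha' fun j hj hjR => (h2 j hj hjR).1, by omega⟩
  · obtain ⟨u, hu, hu'⟩ := hleft a ha h3
    have h4 : A (i + 1) = some (a + 2 + 1) := (h2 1 le_rfl (by omega)).eq_some_add ha'
    exact ⟨u, _, hu', hright _ h4 fun j hj hjR => h2 j (by omega) hjR, by omega⟩

/-- Within distance `R` after `i`, isolation at `i` forces a unit step into `i'`, or else `i' = i +
1` directly after a deletion. A deletion at `i'` contradicts that `i'` is kept; an insertion there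
needs a step of 2 from a kept `i' - 1`. -/
theorem PartialStrictMono.lt_of_isolated (hA : PartialStrictMono A) {R i i' : ℕ} (hi : 1 ≤ i)
    (h : IsolatedDel A R i ∨ IsolatedIns A R i) (h' : IsolatedDel A R i' ∨ IsolatedIns A R i')
    (hlt : i < i') : i + R < i' := by
  by_contra! hle
  have hdel : ∀ l, 1 ≤ l → IsolatedDel A R l → ∀ b, A l ≠ some b := by
    rintro l hl ⟨⟨a, ha, ha'⟩, -⟩ b hb
    have h1 := hA _ _ _ _ (by omega : l - 1 < l) ha hb
    have h2 := hA _ _ _ _ (by omega : l < l + 1) hb ha'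
    omega
  have hstep : StepBy A (i' - 1) i' 1 ∨
      IsolatedDel A R i ∧ i' = i + 1 ∧ ∃ b, A i' = some b := by
    obtain ⟨j, rfl⟩ := Nat.exists_eq_add_of_le hlt.le
    rcases h with hd | hin
    · rcases Nat.lt_or_ge j 2 with hj | hj
      · obtain rfl : j = 1 := by omega
        obtain ⟨⟨a, -, ha⟩, -⟩ := id hd
        exact .inr ⟨hd, rfl, _, ha⟩
      · exact .inl (hd.2 j hj (by omega)).1
    · exact .inl (hin.2.1 j (by omega) (by omega))
  rcases h' with h' | h'
  · have := hdel i' (by omega) h'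
    rcases hstep with ⟨a, -, ha⟩ | ⟨-, -, b, hb⟩
    · exact this _ ha
    · exact this _ hb
  · obtain ⟨a, ha, ha'⟩ := h'.1
    rcases hstep with hs | ⟨hd, rfl, -⟩
    · have := hs.eq_some_add ha
      rw [ha'] at this
      simp at this
    · exact hdel i hi hd a (by simpa using ha)

/-- All the cost sits between the two points where `M` meets the diagonals, so outside them `M` runs
along the diagonals to the ends of the block. -/
theorem PartialStrictMono.agreeOnBoundary_of_eq (hM : PartialStrictMono M) {s w u v k l : ℕ}
    (hu : ∀ m < w, A (s + m) = some (u + m)) (hv : ∀ m < w, A (s + w + 1 + m) = some (v + m))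
    (huv : v ≠ u + w + 1) (hcost : blockCost M s (s + 2 * w) ≤ 1)
    (hk : k < w) (hMk : M (s + k) = some (u + k))
    (hl : l < w) (hMl : M (s + w + 1 + l) = some (v + l)) :
    AgreeOnBoundary A M s (s + 2 * w) ∧ blockCost M s (s + 2 * w) = 1 := by
  -- At cost zero both points would lie on a single diagonal.
  have hmid : blockCost M (s + k) (s + w + 1 + l) ≠ 0 := by
    intro h0
    rw [show s + w + 1 + l = s + k + (w + 1 + l - k) by omega] at h0 hMl
    obtain ⟨a, ha⟩ := hM.exists_run_of_blockCost_eq_zero h0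
    have h1 := ha 0 (Nat.zero_le _)
    have h2 := ha _ le_rfl
    rw [hMl] at h2
    rw [add_zero, hMk] at h1
    simp only [Option.some.injEq] at h1 h2
    omega
  have h1 := hM.blockCost_add_le (a := s) (b := s + w + 1 + l) (c := s) (d := s + k)
    (c' := s + k) (d' := s + w + 1 + l) le_rfl (by omega) (by omega) le_rfl
    (.inr ⟨rfl, by simp [hMk]⟩)
  have h2 := hM.blockCost_add_le (a := s) (b := s + 2 * w) (c := s) (d := s + w + 1 + l)
    (c' := s + w + 1 + l) (d' := s + 2 * w) le_rfl (by omega) (by omega) le_rfl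
    (.inr ⟨rfl, by simp [hMl]⟩)
  have hMs : M s = some u := by
    obtain ⟨a, ha⟩ := hM.exists_run_of_blockCost_eq_zero (c := s) (d := k) (by omega)
    have h3 := ha k le_rfl
    rw [hMk] at h3
    have h4 := ha 0 (Nat.zero_le _)
    simp only [Option.some.injEq, Nat.add_right_cancel_iff] at h3
    rw [h3]; exact h4
  have hMe : M (s + 2 * w) = some (v + (w - 1)) := by
    have h0 : blockCost M (s + w + 1 + l) (s + w + 1 + l + (w - 1 - l)) = 0 := by
      rw [show s + w + 1 + l + (w - 1 - l) = s + 2 * w by omega]; omega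
    obtain ⟨a, ha⟩ := hM.exists_run_of_blockCost_eq_zero h0
    have h3 := ha 0 (Nat.zero_le _)
    rw [add_zero, hMl] at h3
    have h4 := ha _ le_rfl
    simp only [Option.some.injEq] at h3
    rw [show s + w + 1 + l + (w - 1 - l) = s + 2 * w by omega] at h4
    rw [h4]; congr 1; omega
  refine ⟨⟨⟨u, hu 0 (by omega), ?_, ?_⟩, ⟨v + (w - 1), ?_, ?_, ?_⟩⟩, by omega⟩
  · exact Finset.mem_coe.2 (mem_blockValues.2 ⟨s, ⟨le_rfl, by omega⟩, hMs⟩)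
  · intro b hb
    obtain ⟨r, hr, hMr⟩ := mem_blockValues.1 (Finset.mem_coe.1 hb)
    by_contra! hlt
    have := hM.lt_of_lt hMr hMs hlt
    omega
  · rw [← hv (w - 1) (by omega)]; congr 1; omega
  · exact Finset.mem_coe.2 (mem_blockValues.2 ⟨_, ⟨by omega, le_rfl⟩, hMe⟩)
  · intro b hb
    obtain ⟨r, hr, hMr⟩ := mem_blockValues.1 (Finset.mem_coe.1 hb)
    by_contra! hlt
    have := hM.lt_of_lt hMe hMr hlt
    omega

/-- On a stretch of length `2 * h` of cost at most `1`, one of the two halves has no edits. -/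
theorem PartialStrictMono.exists_half_run (hM : PartialStrictMono M) {a b s h : ℕ} (ha : a ≤ s)
    (hb : s + 2 * h ≤ b + 1) (hh : 1 ≤ h) (hcost : blockCost M a b ≤ 1) :
    ∃ k u, s ≤ k ∧ k + h ≤ s + 2 * h ∧ ∀ t < h, M (k + t) = some (u + t) := by
  have h1 := hM.blockCost_add_le (a := a) (b := b) (c := s) (d := s + (h - 1))
    (c' := s + h) (d' := s + h + (h - 1)) ha (by omega) (by omega) (by omega) (.inl (by omega))
  rcases Nat.eq_zero_or_pos (blockCost M s (s + (h - 1))) with h0 | h0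
  · obtain ⟨u, hu⟩ := hM.exists_run_of_blockCost_eq_zero h0
    exact ⟨s, u, le_rfl, by omega, fun t ht => hu t (by omega)⟩
  · obtain ⟨u, hu⟩ := hM.exists_run_of_blockCost_eq_zero (c := s + h) (d := h - 1) (by omega)
    exact ⟨s + h, u, by omega, by omega, fun t ht => hu t (by omega)⟩

theorem PartialStrictMono.exists_diverging_run (hM : PartialStrictMono M) {s w h u v : ℕ}
    (hu : ∀ m < w, A (s + m) = some (u + m)) (hv : ∀ m < w, A (s + w + 1 + m) = some (v + m))
    (huv : v ≠ u + w + 1) (hcost : blockCost M s (s + 2 * w) ≤ 1) (hh : 1 ≤ h) (hw : 2 * h ≤ w)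
    (hbad : ¬ (AgreeOnBoundary A M s (s + 2 * w) ∧ blockCost M s (s + 2 * w) = 1)) :
    ∃ k a, s ≤ k ∧ k + h ≤ s + 2 * w + 1 ∧
      ∀ t < h, M (k + t) = some (a + t) ∧ A (k + t) ≠ some (a + t) := by
  -- A side whose diagonal `M` never meets has `w ≥ 2h` positions, hence an error-free half of
  -- length `h` avoiding `A`.
  by_cases hl : ∃ k < w, M (s + k) = some (u + k)
  · by_cases hr : ∃ l < w, M (s + w + 1 + l) = some (v + l)
    · obtain ⟨k, hk, hMk⟩ := hl
      obtain ⟨l, hl, hMl⟩ := hr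
      exact absurd (hM.agreeOnBoundary_of_eq hu hv huv hcost hk hMk hl hMl) hbad
    · push Not at hr
      obtain ⟨k, a, hk1, hk2, hrun⟩ := hM.exists_half_run (a := s) (b := s + 2 * w)
        (s := s + w + 1) (by omega) (by omega) hh hcost
      refine ⟨k, a, by omega, by omega, fun t ht => ⟨hrun t ht, fun hA => ?_⟩⟩
      obtain ⟨m, hm⟩ := Nat.exists_eq_add_of_le (show s + w + 1 ≤ k + t by omega)
      rw [hm, hv m (by omega)] at hA
      exact hr m (by omega) (by rw [← hm, hrun t ht, hA])
  · push Not at hl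
    obtain ⟨k, a, hk1, hk2, hrun⟩ := hM.exists_half_run (a := s) (b := s + 2 * w)
      (s := s) (by omega) (by omega) hh hcost
    refine ⟨k, a, by omega, by omega, fun t ht => ⟨hrun t ht, fun hA => ?_⟩⟩
    obtain ⟨m, hm⟩ := Nat.exists_eq_add_of_le (show s ≤ k + t by omega)
    rw [hm, hu m (by omega)] at hA
    exact hl m (by omega) (by rw [← hm, hrun t ht, hA])

end IsolatedBlocks

/-! ### Diverging edits and their runs -/

section DivergingRuns

open Classical in
/-- The isolated edits on whose block `M` has cost at most `1`, but which are not agreeing. -/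
noncomputable def diverging (ε p : ℝ) (n : ℕ) (A M : ℕ → Option ℕ) : Finset ℕ :=
  (isolated ε p n A).filter fun i => blockCost M (i - ⌊ε / p⌋₊) (i + ⌊ε / p⌋₊) ≤ 1 ∧
    ¬ (AgreeOnBoundary A M (i - ⌊ε / p⌋₊) (i + ⌊ε / p⌋₊) ∧
      blockCost M (i - ⌊ε / p⌋₊) (i + ⌊ε / p⌋₊) = 1)

/-- `x` and `y` match along `B` runs of length `h`, which start at the positions `K r` of `x` and
`U r` of `y`, follow one another, and contain no pair of positions that `A` matches. -/
def DivergingRuns {α : Type*} (h B : ℕ) (A : ℕ → Option ℕ) (x y : ℕ → α) (K U : Fin B → ℕ) :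
    Prop :=
  (∀ r r', r < r' → K r + h ≤ K r' ∧ U r + h ≤ U r') ∧
    ∀ r, ∀ t < h, A (K r + t) ≠ some (U r + t) ∧ x (K r + t) = y (U r + t)

variable {α : Type*} {ε p : ℝ} {n m : ℕ} {x y : ℕ → α} {A M : ℕ → Option ℕ}

theorem two_mul_floor_le (hp : 0 ≤ p) (hε : 0 ≤ ε) : 2 * ⌊ε / p⌋₊ ≤ ⌊2 * ε / p⌋₊ := by
  apply Nat.le_floor
  push_cast
  have := Nat.floor_le (div_nonneg hε hp)
  rw [mul_div_assoc]
  linarith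

theorem PartialStrictMono.lt_of_mem_isolated (hA : PartialStrictMono A) {i i' : ℕ}
    (hi : i ∈ isolated ε p n A) (hi' : i' ∈ isolated ε p n A) (hlt : i < i') :
    i + ⌊2 * ε / p⌋₊ < i' := by
  classical
  simp only [isolated, Finset.mem_filter] at hi hi'
  exact hA.lt_of_isolated hi.2.1.1 hi.2.2.2 hi'.2.2.2 hlt

/-- Each block accounts for 2: an agreeing edit counts 1 plus its cost 1, a diverging one is counted
twice, any other block costs at least 2. Disjointness bounds the sum of the costs by the cost of
`M`. -/
theorem two_mul_card_isolated_le (hp : 0 ≤ p) (hε : 0 ≤ ε) (hA : PartialStrictMono A)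
    (hM : IsAlignment n m x y M) :
    2 * (isolated ε p n A).card ≤
      (agreeing ε p n A M).card + alignmentCost n m M + 2 * (diverging ε p n A M).card := by
  classical
  have hw := two_mul_floor_le hp hε
  have h1 := hM.sum_blockCost_le (isolated ε p n A) (fun i => i - ⌊ε / p⌋₊)
    (fun i => i + ⌊ε / p⌋₊) (fun i hi => ?_) (fun i hi j hj hij => ?_)
  · have h2 : ∑ i ∈ isolated ε p n A, 2 ≤ ∑ i ∈ isolated ε p n A,
        ((if AgreeOnBoundary A M (i - ⌊ε / p⌋₊) (i + ⌊ε / p⌋₊) ∧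
          blockCost M (i - ⌊ε / p⌋₊) (i + ⌊ε / p⌋₊) = 1 then 1 else 0) +
        blockCost M (i - ⌊ε / p⌋₊) (i + ⌊ε / p⌋₊) +
        2 * if blockCost M (i - ⌊ε / p⌋₊) (i + ⌊ε / p⌋₊) ≤ 1 ∧
          ¬ (AgreeOnBoundary A M (i - ⌊ε / p⌋₊) (i + ⌊ε / p⌋₊) ∧
            blockCost M (i - ⌊ε / p⌋₊) (i + ⌊ε / p⌋₊) = 1) then 1 else 0) := by
      refine Finset.sum_le_sum fun i _ => ?_
      by_cases hag : AgreeOnBoundary A M (i - ⌊ε / p⌋₊) (i + ⌊ε / p⌋₊) ∧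
          blockCost M (i - ⌊ε / p⌋₊) (i + ⌊ε / p⌋₊) = 1
      · rw [if_pos hag, hag.2]; omega
      · by_cases hc : blockCost M (i - ⌊ε / p⌋₊) (i + ⌊ε / p⌋₊) ≤ 1
        · rw [if_neg hag, if_pos ⟨hc, hag⟩]; omega
        · omega
    rw [Finset.sum_add_distrib, Finset.sum_add_distrib, ← Finset.mul_sum, ← Finset.card_filter,
      ← Finset.card_filter, Finset.sum_const, smul_eq_mul] at h2
    unfold agreeing diverging
    omega
  · simp only [isolated, Finset.mem_filter] at hi
    omega
  · rcases lt_or_gt_of_ne hij with h | h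
    · have := hA.lt_of_mem_isolated hi hj h
      left; omega
    · have := hA.lt_of_mem_isolated hj hi h
      right; omega

/-- This removes `M`: only the starting points of the runs remain, so the union bound ranges over
these and not over alignments. -/
theorem exists_divergingRuns (hp : 0 ≤ p) (hε : 0 ≤ ε) (hA : PartialStrictMono A)
    (hM : IsAlignment n m x y M) {h B : ℕ} (hh : 1 ≤ h) (hw : 2 * h ≤ ⌊ε / p⌋₊)
    (hB : B ≤ (diverging ε p n A M).card) :
    ∃ K U : Fin B → ℕ, DivergingRuns h B A x y K U ∧ (∀ r, K r < n) ∧ ∀ r, U r < m := by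
  classical
  have hR := two_mul_floor_le hp hε
  have hrun : ∀ i ∈ diverging ε p n A M, ∃ k a, i - ⌊ε / p⌋₊ ≤ k ∧ k + h ≤ i + ⌊ε / p⌋₊ + 1 ∧
      ∀ t < h, M (k + t) = some (a + t) ∧ A (k + t) ≠ some (a + t) := by
    intro i hi
    simp only [diverging, isolated, Finset.mem_filter] at hi
    obtain ⟨⟨-, -, hiR, hiso⟩, hcost, hbad⟩ := hi
    obtain ⟨u, v, hu, hv, huv⟩ := exists_runs_of_isolated hiso (by omega : 1 ≤ ⌊ε / p⌋₊)
      (by omega) hiR.1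
    have hend : i + ⌊ε / p⌋₊ = i - ⌊ε / p⌋₊ + 2 * ⌊ε / p⌋₊ := by omega
    rw [hend] at hcost hbad ⊢
    exact hM.partialStrictMono.exists_diverging_run hu hv huv hcost hh hw hbad
  choose! k a hk1 hk2 hka using hrun
  obtain ⟨S, hS, hSB⟩ := Finset.exists_subset_card_eq hB
  have hmem : ∀ r, S.orderEmbOfFin hSB r ∈ diverging ε p n A M := fun r =>
    hS (S.orderEmbOfFin_mem hSB r)
  have hMk : ∀ r, M (k (S.orderEmbOfFin hSB r)) = some (a (S.orderEmbOfFin hSB r)) := fun r =>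
    (hka _ (hmem r) 0 (by omega)).1
  refine ⟨fun r => k (S.orderEmbOfFin hSB r), fun r => a (S.orderEmbOfFin hSB r),
    ⟨fun r r' hr => ?_, fun r t ht => ?_⟩, fun r => hM.lt_left _ _ (hMk r),
    fun r => hM.lt_right _ _ (hMk r)⟩
  · have hlt : S.orderEmbOfFin hSB r < S.orderEmbOfFin hSB r' := by simpa using hr
    have h1 := hA.lt_of_mem_isolated (Finset.filter_subset _ _ (hmem r))
      (Finset.filter_subset _ _ (hmem r')) hlt
    have h2 := hk2 _ (hmem r)
    have h3 := hk1 _ (hmem r')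
    have h4 : k (S.orderEmbOfFin hSB r) + h ≤ k (S.orderEmbOfFin hSB r') := by omega
    refine ⟨h4, ?_⟩
    change a (S.orderEmbOfFin hSB r) + h ≤ a (S.orderEmbOfFin hSB r')
    have h5 := (hka _ (hmem r) (h - 1) (by omega)).1
    have h6 := hM.mono _ _ _ _ (by omega) h5 (hMk r')
    omega
  · have h1 := hka _ (hmem r) t ht
    exact ⟨h1.2, hM.eq_symbol _ _ h1.1⟩

/-- The increasing enumeration of a finite set of natural numbers. -/
noncomputable def enumeration {N B : ℕ} (S : (Finset.range N).powersetCard B) : Fin B → ℕ :=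
  S.1.orderEmbOfFin (Finset.mem_powersetCard.1 S.2).2

theorem exists_eq_enumeration {N B : ℕ} {f : Fin B → ℕ} (hf : StrictMono f)
    (hN : ∀ r, f r < N) : ∃ S : (Finset.range N).powersetCard B, f = enumeration S := by
  classical
  have hcard : (Finset.univ.image f).card = B := by
    rw [Finset.card_image_of_injective _ hf.injective, Finset.card_univ, Fintype.card_fin]
  refine ⟨⟨Finset.univ.image f, Finset.mem_powersetCard.2 ⟨?_, hcard⟩⟩, ?_⟩
  · intro j hj
    obtain ⟨r, -, rfl⟩ := Finset.mem_image.1 hj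
    exact Finset.mem_range.2 (hN r)
  · exact Finset.orderEmbOfFin_unique hcard
      (fun r => Finset.mem_image_of_mem _ (Finset.mem_univ r)) hf

theorem DivergingRuns.exists_enumeration {h B N : ℕ} (hh : 1 ≤ h) {K U : Fin B → ℕ}
    (hD : DivergingRuns h B A x y K U) (hK : ∀ r, K r < n) (hU : ∀ r, U r < N) :
    ∃ (S : (Finset.range n).powersetCard B) (T : (Finset.range N).powersetCard B),
      DivergingRuns h B A x y (enumeration S) (enumeration T) := by
  obtain ⟨S, rfl⟩ := exists_eq_enumeration
    (fun r r' hr => by have := (hD.1 r r' hr).1; omega : StrictMono K) hK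
  obtain ⟨T, rfl⟩ := exists_eq_enumeration
    (fun r r' hr => by have := (hD.1 r r' hr).2; omega : StrictMono U) hU
  exact ⟨S, T, hD⟩

variable [Fintype α] [Nonempty α] [MeasurableSpace α] [DiscreteMeasurableSpace α]

theorem wordMeasure_divergingRuns_le (hA : PartialStrictMono A) (h B : ℕ) (K U : Fin B → ℕ) :
    wordMeasure α {z | DivergingRuns h B A z.1 (outputWord A z.1 z.2) K U} ≤
      (Fintype.card α : ENNReal)⁻¹ ^ (B * h) := by
  classical
  by_cases hsep : (∀ r r', r < r' → K r + h ≤ K r' ∧ U r + h ≤ U r') ∧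
      ∀ r, ∀ t < h, A (K r + t) ≠ some (U r + t)
  · obtain ⟨hsep, hne⟩ := hsep
    -- The runs are glued into one strictly increasing matching `g` on `B * h` positions. Unless
    -- they are separated and unplanted, the event is empty.
    set f : Fin B × Fin h → ℕ := fun e => K e.1 + e.2 with hf
    set f' : Fin B × Fin h → ℕ := fun e => U e.1 + e.2 with hf'
    have hlt : ∀ e e', f e < f e' → f' e < f' e' := by
      intro e e' hee
      have h1 := e.2.2
      have h2 := e'.2.2
      simp only [hf, hf'] at hee ⊢
      rcases lt_trichotomy e.1 e'.1 with h3 | h3 | h3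
      · have := (hsep _ _ h3).2; omega
      · rw [h3] at hee ⊢; omega
      · have := (hsep _ _ h3).1; omega
    have hinj : Function.Injective f := by
      intro e e' hee
      have h1 := e.2.2
      have h2 := e'.2.2
      simp only [hf] at hee
      rcases lt_trichotomy e.1 e'.1 with h3 | h3 | h3
      · have := (hsep _ _ h3).1; omega
      · rw [h3] at hee
        exact Prod.ext h3 (Fin.ext (by omega))
      · have := (hsep _ _ h3).1; omega
    set g : ℕ → ℕ := Function.extend f f' 0
    have hg : ∀ e, g (f e) = f' e := fun e => hinj.extend_apply _ _ _
    have hcard : (Finset.univ.image f).card = B * h := by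
      rw [Finset.card_image_of_injective _ hinj]; simp
    have hmono : StrictMonoOn g (Finset.univ.image f : Finset ℕ) := by
      intro a ha b hb hab
      obtain ⟨e, -, rfl⟩ := Finset.mem_image.1 (Finset.mem_coe.1 ha)
      obtain ⟨e', -, rfl⟩ := Finset.mem_image.1 (Finset.mem_coe.1 hb)
      rw [hg, hg]
      exact hlt _ _ hab
    have hne' : ∀ k ∈ Finset.univ.image f, A k ≠ some (g k) := by
      intro k hk
      obtain ⟨e, -, rfl⟩ := Finset.mem_image.1 hk
      rw [hg]
      exact hne _ _ e.2.2
    rw [← hcard]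
    refine (measure_mono ?_).trans (measure_matching_le (α := α) hA g _ hmono hne')
    intro z hz k hk
    obtain ⟨e, -, rfl⟩ := Finset.mem_image.1 hk
    rw [hg]
    exact (hz.2 e.1 e.2 e.2.2).2
  · have : {z : (ℕ → α) × (ℕ → α) | DivergingRuns h B A z.1 (outputWord A z.1 z.2) K U} = ∅ := by
      refine Set.eq_empty_of_forall_notMem fun z hz => hsep ⟨hz.1, fun r t ht => (hz.2 r t ht).1⟩
    rw [this, measure_empty]
    exact zero_le

end DivergingRuns

/-! ### Measurability and the union bound -/

section Measurability

theorem measurable_pointers (t : ℕ) : Measurable fun ops : ℕ → EditOp => pointers ops t := by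
  induction t with
  | zero => exact measurable_const
  | succ t ih =>
    let f : EditOp × (ℕ × ℕ) → ℕ × ℕ := fun z =>
      match z.1 with
      | .keep => (z.2.1 + 1, z.2.2 + 1)
      | .del => (z.2.1 + 1, z.2.2)
      | .ins => (z.2.1, z.2.2 + 1)
    have hf : Measurable f := Measurable.of_discrete
    exact hf.comp ((measurable_pi_apply t).prodMk ih)

theorem measurableSet_planted_eq (i j : ℕ) :
    MeasurableSet {ops : ℕ → EditOp | planted ops i = some j} := by
  have : {ops : ℕ → EditOp | planted ops i = some j} =
      ⋃ t, (fun ops : ℕ → EditOp => ops t) ⁻¹' {.keep} ∩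
        (fun ops => pointers ops t) ⁻¹' {(i, j)} := by
    ext ops
    simp [planted_eq_some_iff]
  rw [this]
  exact .iUnion fun t => (measurable_pi_apply t .of_discrete).inter
    (measurable_pointers t (.singleton _))

variable {α : Type*} [Fintype α] [MeasurableSpace α] [DiscreteMeasurableSpace α]

theorem measurableSet_eq_trace (k j : ℕ) :
    MeasurableSet {ω : (ℕ → EditOp) × (ℕ → α) × (ℕ → α) |
      ω.2.1 k = trace ω.1 ω.2.1 ω.2.2 j} := by
  have hx : ∀ i, Measurable fun ω : (ℕ → EditOp) × (ℕ → α) × (ℕ → α) => ω.2.1 i := fun i =>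
    (measurable_pi_apply i).comp (measurable_fst.comp measurable_snd)
  have hc : ∀ i, Measurable fun ω : (ℕ → EditOp) × (ℕ → α) × (ℕ → α) => ω.2.2 i := fun i =>
    (measurable_pi_apply i).comp (measurable_snd.comp measurable_snd)
  have hP : ∀ i, MeasurableSet {ω : (ℕ → EditOp) × (ℕ → α) × (ℕ → α) |
      planted ω.1 i = some j} := fun i => measurable_fst (measurableSet_planted_eq i j)
  have : {ω : (ℕ → EditOp) × (ℕ → α) × (ℕ → α) | ω.2.1 k = trace ω.1 ω.2.1 ω.2.2 j} =
      (⋃ i, {ω | planted ω.1 i = some j} ∩ {ω | ω.2.1 k = ω.2.1 i}) ∪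
        ((⋂ i, {ω | planted ω.1 i = some j}ᶜ) ∩ {ω | ω.2.1 k = ω.2.2 j}) := by
    ext ω
    simp only [Set.mem_union, Set.mem_iUnion, Set.mem_inter_iff, Set.mem_iInter,
      Set.mem_compl_iff, Set.mem_ofPred_eq]
    change ω.2.1 k = outputWord (planted ω.1) ω.2.1 ω.2.2 j ↔ _
    by_cases hj : ∃ i, planted ω.1 i = some j
    · obtain ⟨i, hi⟩ := hj
      have hmono := partialStrictMono_planted ω.1
      rw [outputWord_of_eq hmono hi]
      constructor
      · exact fun h => .inl ⟨i, hi, h⟩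
      · rintro (⟨i', hi', h⟩ | ⟨h, -⟩)
        · rwa [hmono.eq_of_eq hi hi']
        · exact absurd hi (h i)
    · push Not at hj
      rw [outputWord_of_ne hj]
      constructor
      · exact fun h => .inr ⟨hj, h⟩
      · rintro (⟨i', hi', h⟩ | ⟨-, h⟩)
        · exact absurd hi' (hj i')
        · exact h
  rw [this]
  exact (MeasurableSet.iUnion fun i => (hP i).inter (measurableSet_eq_fun (hx k) (hx i))).union
    ((MeasurableSet.iInter fun i => (hP i).compl).inter (measurableSet_eq_fun (hx k) (hc j)))

theorem measurableSet_divergingRuns (h B : ℕ) (K U : Fin B → ℕ) :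
    MeasurableSet {ω : (ℕ → EditOp) × (ℕ → α) × (ℕ → α) |
      DivergingRuns h B (planted ω.1) ω.2.1 (trace ω.1 ω.2.1 ω.2.2) K U} := by
  have : {ω : (ℕ → EditOp) × (ℕ → α) × (ℕ → α) |
      DivergingRuns h B (planted ω.1) ω.2.1 (trace ω.1 ω.2.1 ω.2.2) K U} =
      {_ω | ∀ r r', r < r' → K r + h ≤ K r' ∧ U r + h ≤ U r'} ∩
      ⋂ r, ⋂ t, ⋂ (_ : t < h), {ω | planted ω.1 (K r + t) = some (U r + t)}ᶜ ∩
        {ω | ω.2.1 (K r + t) = trace ω.1 ω.2.1 ω.2.2 (U r + t)} := by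
    ext ω
    simp [DivergingRuns]
  rw [this]
  exact (MeasurableSet.const _).inter (.iInter fun r => .iInter fun t => .iInter fun _ =>
    (MeasurableSet.compl (measurable_fst (measurableSet_planted_eq _ _))).inter
      (measurableSet_eq_trace _ _))

/-- Fubini: the bound holds for each fixed sequence of channel steps. -/
theorem channelMeasure_divergingRuns_le [Nonempty α] (p : ℝ) (hp : p ∈ Set.Icc (0 : ℝ) 1)
    (h B : ℕ) (K U : Fin B → ℕ) :
    channelMeasure α p hp {ω | DivergingRuns h B (planted ω.1) ω.2.1
      (trace ω.1 ω.2.1 ω.2.2) K U} ≤ (Fintype.card α : ENNReal)⁻¹ ^ (B * h) := by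
  change (opsMeasure p hp).prod (wordMeasure α) _ ≤ _
  rw [Measure.prod_apply (measurableSet_divergingRuns h B K U)]
  calc _ ≤ ∫⁻ _, (Fintype.card α : ENNReal)⁻¹ ^ (B * h) ∂(opsMeasure p hp) :=
        lintegral_mono fun ops =>
          wordMeasure_divergingRuns_le (partialStrictMono_planted ops) h B K U
    _ = _ := by simp

theorem channelMeasure_iUnion_divergingRuns_le [Nonempty α] (p : ℝ)
    (hp : p ∈ Set.Icc (0 : ℝ) 1) (h B n N : ℕ) :
    channelMeasure α p hp (⋃ (S : (Finset.range n).powersetCard B)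
        (T : (Finset.range N).powersetCard B),
      {ω | DivergingRuns h B (planted ω.1) ω.2.1 (trace ω.1 ω.2.1 ω.2.2)
        (enumeration S) (enumeration T)}) ≤
      n.choose B * (N.choose B * (Fintype.card α : ENNReal)⁻¹ ^ (B * h)) := by
  refine (measure_iUnion_fintype_le _ _).trans ((Finset.sum_le_sum fun S _ =>
    (measure_iUnion_fintype_le _ _).trans (Finset.sum_le_sum fun T _ =>
      channelMeasure_divergingRuns_le p hp h B _ _)).trans_eq ?_)
  simp

end Measurability

/-! ### Numerical estimates -/

section Estimates

theorem choose_le_exp_mul_pow (N : ℕ) {B : ℕ} {c : ℝ} (hN : (N : ℝ) ≤ c * B) :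
    (N.choose B : ℝ) ≤ (Real.exp 1 * c) ^ B := by
  have hB : (0 : ℝ) < B.factorial := by exact_mod_cast B.factorial_pos
  have h1 : (B : ℝ) ^ B / B.factorial ≤ Real.exp 1 ^ B := by
    rw [← Real.exp_nat_mul, mul_one]
    exact Real.pow_div_factorial_le_exp _ (Nat.cast_nonneg B) B
  by_cases hc : 0 ≤ c
  · calc (N.choose B : ℝ) ≤ (N : ℝ) ^ B / B.factorial := Nat.choose_le_pow_div B N
      _ ≤ (c * B) ^ B / B.factorial := by gcongr
      _ = c ^ B * ((B : ℝ) ^ B / B.factorial) := by rw [mul_pow, mul_div_assoc]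
      _ ≤ c ^ B * Real.exp 1 ^ B := by gcongr
      _ = (Real.exp 1 * c) ^ B := by rw [mul_pow, mul_comm]
  · have : (B : ℝ) = 0 := by
      by_contra h
      have : (0 : ℝ) < B := lt_of_le_of_ne (Nat.cast_nonneg B) (Ne.symm h)
      have h0 : (0 : ℝ) ≤ N := Nat.cast_nonneg N
      nlinarith
    have h0 : B = 0 := by exact_mod_cast this
    subst h0
    simp

variable {p ε : ℝ}

/-- With `h = ⌊w/2⌋`, `42 log₂(1/p) ≤ ε/p < w + 1 ≤ 2h + 2`; the two roundings cost the factor 2. -/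
theorem half_pow_le (hp0 : 0 < p) (hε : 42 * p * Real.logb 2 (1 / p) ≤ ε) :
    (1 / 2 : ℝ) ^ (⌊ε / p⌋₊ / 2) ≤ 2 * p ^ 21 := by
  have h1 : 42 * Real.logb 2 (1 / p) ≤ ε / p := by
    rw [le_div_iff₀ hp0]; linarith
  have h2 := Nat.lt_floor_add_one (ε / p)
  have h3 : ((⌊ε / p⌋₊ : ℕ) : ℝ) ≤ 2 * (⌊ε / p⌋₊ / 2 : ℕ) + 1 := by
    have : ⌊ε / p⌋₊ ≤ 2 * (⌊ε / p⌋₊ / 2) + 1 := by omega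
    exact_mod_cast this
  have h4 : 21 * Real.logb 2 (1 / p) - 1 ≤ ((⌊ε / p⌋₊ / 2 : ℕ) : ℝ) := by linarith
  have h5 : (2 : ℝ) ^ (21 * Real.logb 2 (1 / p) - 1) ≤ 2 ^ (⌊ε / p⌋₊ / 2) := by
    rw [← Real.rpow_natCast 2 (⌊ε / p⌋₊ / 2)]
    exact Real.rpow_le_rpow_of_exponent_le (by norm_num) h4
  have h6 : (2 : ℝ) ^ (21 * Real.logb 2 (1 / p) - 1) = (2 * p ^ 21)⁻¹ := by
    rw [Real.rpow_sub (by norm_num), mul_comm, Real.rpow_mul (by norm_num),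
      Real.rpow_logb (by norm_num) (by norm_num) (by positivity), Real.rpow_one]
    rw [show (21 : ℝ) = (21 : ℕ) by norm_num, Real.rpow_natCast]
    field_simp
  rw [h6] at h5
  rw [one_div, inv_pow]
  exact inv_le_of_inv_le₀ (by positivity) h5

theorem choose_mul_choose_mul_le (hp0 : 0 < p) (hε : 42 * p * Real.logb 2 (1 / p) ≤ ε)
    (hpε : p ≤ ε) (hε' : ε ≤ 1 / 23) (n : ℕ) :
    (n.choose ⌈ε * p * n⌉₊ : ℝ) * (((2 * n).choose ⌈ε * p * n⌉₊ : ℝ) *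
      (1 / 2 : ℝ) ^ (⌈ε * p * n⌉₊ * (⌊ε / p⌋₊ / 2))) ≤
      Real.exp (-(ε ^ 2 * p ^ 2 * n) / 2) := by
  have hε0 : 0 < ε := hp0.trans_le hpε
  have hceil := Nat.le_ceil (ε * p * n)
  set B := ⌈ε * p * n⌉₊
  have hn : (n : ℝ) ≤ 1 / (ε * p) * B := by
    rw [one_div, ← div_eq_inv_mul, le_div_iff₀ (by positivity)]; linarith
  have h1 := choose_le_exp_mul_pow n hn
  have h2 := choose_le_exp_mul_pow (2 * n) (B := B) (c := 2 * (1 / (ε * p)))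
    (by push_cast; linarith)
  have h3 := pow_le_pow_left₀ (by positivity) (half_pow_le hp0 hε) B
  rw [← pow_mul, mul_comm (_ / 2) B] at h3
  have he : Real.exp 1 ≤ 3 := Real.exp_one_lt_three.le
  -- Since `ε ≥ p`, the two binomials cost at most `p^(-4)` per run, up to constants, against the
  -- gain `p^21`.
  have hbase : Real.exp 1 * (1 / (ε * p)) * (Real.exp 1 * (2 * (1 / (ε * p)))) * (2 * p ^ 21) ≤
      Real.exp (-1) := by
    have hεp : 1 / (ε * p) ≤ 1 / p ^ 2 := by
      apply one_div_le_one_div_of_le (by positivity); nlinarith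
    have hp : p ≤ 1 / 23 := hpε.trans hε'
    calc Real.exp 1 * (1 / (ε * p)) * (Real.exp 1 * (2 * (1 / (ε * p)))) * (2 * p ^ 21)
        ≤ 3 * (1 / p ^ 2) * (3 * (2 * (1 / p ^ 2))) * (2 * p ^ 21) := by gcongr
      _ = 36 * p ^ 17 := by field_simp; norm_num
      _ ≤ 36 * (1 / 23) ^ 17 := by gcongr
      _ ≤ 3⁻¹ := by norm_num
      _ ≤ (Real.exp 1)⁻¹ := inv_anti₀ (Real.exp_pos 1) he
      _ = Real.exp (-1) := (Real.exp_neg 1).symm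
  calc (n.choose B : ℝ) * (((2 * n).choose B : ℝ) * (1 / 2 : ℝ) ^ (B * (⌊ε / p⌋₊ / 2)))
      ≤ (Real.exp 1 * (1 / (ε * p))) ^ B *
        ((Real.exp 1 * (2 * (1 / (ε * p)))) ^ B * (2 * p ^ 21) ^ B) := by gcongr
    _ = (Real.exp 1 * (1 / (ε * p)) * (Real.exp 1 * (2 * (1 / (ε * p)))) * (2 * p ^ 21)) ^ B := by
        rw [← mul_assoc, ← mul_pow, ← mul_pow]
    _ ≤ Real.exp (-1) ^ B := by gcongr
    _ = Real.exp (-B) := by rw [← Real.exp_nat_mul]; ring_nf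
    _ ≤ Real.exp (-(ε ^ 2 * p ^ 2 * n) / 2) := by
        apply Real.exp_le_exp.2
        have h4 : ε * p ≤ 1 := by nlinarith
        have h5 : ε ^ 2 * p ^ 2 * n ≤ ε * p * n := by
          have : 0 ≤ ε * p * n := by positivity
          nlinarith
        have : 0 ≤ ε ^ 2 * p ^ 2 * n := by positivity
        linarith

end Estimates

/-! ### Combining the estimates -/

section Main

theorem card_agreeing_ge {α : Type*} {n m : ℕ} {p ε δ : ℝ} {x y : ℕ → α} {ops : ℕ → EditOp}
    {M : ℕ → Option ℕ}
    (hp0 : 0 < p) (hp1 : p ≤ 1 / 23) (hε' : ε ≤ 1 / 23) (hδ : p ≤ δ) (hδ' : δ ≤ ε)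
    (hw : 2 ≤ ⌊ε / p⌋₊) (hn : 2 ≤ ε ^ 2 * p ^ 2 * n)
    (hM : IsAlignment n m x y M) (hcost : (alignmentCost n m M : ℝ) ≤ (1 + δ) * p * n)
    (hsum : -(ε * p * n) < ∑ t ∈ Finset.range n, isolationWeight p (⌊2 * ε / p⌋₊ + 1) t ops *
      (editIndicator (ops t) - p))
    (hruns : ∀ (S : (Finset.range n).powersetCard ⌈ε * p * n⌉₊)
      (T : (Finset.range (2 * n)).powersetCard ⌈ε * p * n⌉₊),
      ¬ DivergingRuns (⌊ε / p⌋₊ / 2) ⌈ε * p * n⌉₊ (planted ops) x y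
        (enumeration S) (enumeration T)) :
    (1 - 23 * ε - δ) * p * n ≤ ((agreeing ε p n (planted ops) M).card : ℝ) := by
  have hε0 : 0 < ε := by linarith
  have hA := partialStrictMono_planted ops
  -- A cheap alignment itself bounds the length of the trace, so no tail estimate for that length is
  -- needed.
  have hm : m ≤ 2 * n := by
    have h1 := hM.le_add_alignmentCost
    have h2 : (alignmentCost n m M : ℝ) ≤ n := by
      refine hcost.trans ?_
      have : (1 + δ) * p ≤ 1 := by nlinarith
      nlinarith [(Nat.cast_nonneg n : (0 : ℝ) ≤ n)]
    have h3 : alignmentCost n m M ≤ n := by exact_mod_cast h2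
    omega
  have hdiv : ((diverging ε p n (planted ops) M).card : ℝ) < ε * p * n := by
    rw [← Nat.lt_ceil]
    by_contra! hB
    obtain ⟨K, U, hD, hK, hU⟩ := exists_divergingRuns hp0.le hε0.le hA hM
      (by omega : 1 ≤ ⌊ε / p⌋₊ / 2) (by omega) hB
    obtain ⟨S, T, hST⟩ := hD.exists_enumeration (by omega) hK fun r => (hU r).trans_le hm
    exact hruns S T hST
  have hR : 1 ≤ ⌊2 * ε / p⌋₊ := by
    have := two_mul_floor_le hp0.le hε0.le
    omega
  have h1 := sum_isolationWeight_le (ops := ops) hp0.le (⌊2 * ε / p⌋₊ + 1) n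
  have h2 : ((isolatedSteps (⌊2 * ε / p⌋₊ + 1) ops n).card : ℝ) ≤
      (isolated ε p n (planted ops)).card := by exact_mod_cast card_isolatedSteps_le hR
  have h3 : 2 * ((isolated ε p n (planted ops)).card : ℝ) ≤
      (agreeing ε p n (planted ops) M).card + alignmentCost n m M +
        2 * (diverging ε p n (planted ops) M).card := by
    exact_mod_cast two_mul_card_isolated_le hp0.le hε0.le hA hM
  have h4 : p * (⌊2 * ε / p⌋₊ + 1 : ℕ) ≤ 3 * ε := by
    have := Nat.floor_le (div_nonneg (by linarith : 0 ≤ 2 * ε) hp0.le)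
    rw [le_div_iff₀ hp0] at this
    push_cast
    linarith
  generalize (⌊2 * ε / p⌋₊ + 1) = L at *
  have hpn : 0 < p ^ 2 * n := by
    by_contra! h
    nlinarith [sq_nonneg ε]
  -- The loss at the two ends is negligible: `2pL ≤ 6ε` and `p²n ≥ 6`.
  have h5 : 2 * (L : ℝ) ≤ ε * p * n := by
    have h6 : 6 ≤ p ^ 2 * n := by
      have : ε ^ 2 ≤ 1 / 3 := by nlinarith
      nlinarith
    have h7 : p * (2 * (L : ℝ)) ≤ p * (ε * p * n) := by nlinarith
    exact le_of_mul_le_mul_left h7 hp0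
  have h6 : p * L * (p * n) ≤ 3 * ε * (p * n) := by gcongr
  have h7 : 0 ≤ ε * p * n := by positivity
  -- The count of isolated edits loses `6ε` to the weights, `ε` to the deviation and `ε` to the
  -- ends.
  nlinarith

end Main

end IndelChannel

theorem mainTheorem5 {α : Type*} [Fintype α] [Nontrivial α] [MeasurableSpace α]
    [DiscreteMeasurableSpace α] (n : ℕ) (p ε δ : ℝ) (hp : p ∈ Set.Icc (0 : ℝ) 1) (hp0 : 0 < p)
    (hε : 42 * p * Real.logb 2 (1 / p) ≤ ε) (hε' : ε ≤ 1 / 6) (hδ : p ≤ δ) (hδ' : δ ≤ ε) :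
    1 - 4 * Real.exp (-(ε ^ 2 * p ^ 2 * n) / 2) ≤
      (IndelChannel.channelMeasure α p hp).real
        {ω : (ℕ → IndelChannel.EditOp) × (ℕ → α) × (ℕ → α) |
          ∀ M : ℕ → Option ℕ,
            IndelChannel.IsAlignment n (IndelChannel.traceLength ω.1 n) ω.2.1
                (IndelChannel.trace ω.1 ω.2.1 ω.2.2) M →
            (IndelChannel.alignmentCost n (IndelChannel.traceLength ω.1 n) M : ℝ) ≤
                (1 + δ) * p * n →
            (1 - 23 * ε - δ) * p * n ≤
              ((IndelChannel.agreeing ε p n (IndelChannel.planted ω.1) M).card : ℝ)} := by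
  open IndelChannel in
  have hε0 : 0 < ε := by linarith
  have hprob : IsProbabilityMeasure (channelMeasure α p hp) := by
    unfold channelMeasure; infer_instance
  -- Discarding the cases where the claim is trivial leaves `ε < 1/23` and, as `4 exp(-1) > 1`,
  -- `ε²p²n ≥ 2`.
  rcases le_or_gt (1 - 23 * ε - δ) 0 with htriv | hsmall
  · have huniv : {ω : (ℕ → EditOp) × (ℕ → α) × (ℕ → α) | ∀ M : ℕ → Option ℕ,
        IsAlignment n (traceLength ω.1 n) ω.2.1 (trace ω.1 ω.2.1 ω.2.2) M →
        (alignmentCost n (traceLength ω.1 n) M : ℝ) ≤ (1 + δ) * p * n →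
        (1 - 23 * ε - δ) * p * n ≤ ((agreeing ε p n (planted ω.1) M).card : ℝ)} = Set.univ := by
      refine Set.eq_univ_of_forall fun ω M _ _ => ?_
      refine le_trans ?_ (Nat.cast_nonneg _)
      rw [mul_assoc]
      exact mul_nonpos_of_nonpos_of_nonneg htriv (by positivity)
    rw [huniv, probReal_univ]
    have := Real.exp_pos (-(ε ^ 2 * p ^ 2 * n) / 2)
    linarith
  rcases le_or_gt 1 (4 * Real.exp (-(ε ^ 2 * p ^ 2 * n) / 2)) with htriv | hlarge
  · exact (by linarith : _ ≤ (0 : ℝ)).trans measureReal_nonneg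
  have hn : 2 ≤ ε ^ 2 * p ^ 2 * n := by
    by_contra! h
    have h1 : Real.exp (-1) ≤ Real.exp (-(ε ^ 2 * p ^ 2 * n) / 2) :=
      Real.exp_le_exp.2 (by linarith)
    have h2 : (3 : ℝ)⁻¹ ≤ Real.exp (-1) := by
      rw [Real.exp_neg]
      exact inv_anti₀ (Real.exp_pos 1) Real.exp_one_lt_three.le
    linarith
  have hε23 : ε ≤ 1 / 23 := by linarith
  have hp23 : p ≤ 1 / 23 := by linarith
  have hw : 2 ≤ ⌊ε / p⌋₊ := by
    apply Nat.le_floor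
    rw [le_div_iff₀ hp0]
    have : 1 ≤ Real.logb 2 (1 / p) := by
      rw [Real.le_logb_iff_rpow_le (by norm_num) (by positivity), Real.rpow_one,
        le_div_iff₀ hp0]
      linarith
    push_cast
    nlinarith
  set G := {ω : (ℕ → EditOp) × (ℕ → α) × (ℕ → α) | ∀ M : ℕ → Option ℕ,
        IsAlignment n (traceLength ω.1 n) ω.2.1 (trace ω.1 ω.2.1 ω.2.2) M →
        (alignmentCost n (traceLength ω.1 n) M : ℝ) ≤ (1 + δ) * p * n →
        (1 - 23 * ε - δ) * p * n ≤ ((agreeing ε p n (planted ω.1) M).card : ℝ)}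
  set E₁ : Set (ℕ → EditOp) := {z | ∑ t ∈ Finset.range n,
    isolationWeight p (⌊2 * ε / p⌋₊ + 1) t z * (editIndicator (z t) - p) ≤ -(ε * p * n)} with hE₁
  set E₂ : Set ((ℕ → EditOp) × (ℕ → α) × (ℕ → α)) :=
    ⋃ (S : (Finset.range n).powersetCard ⌈ε * p * n⌉₊)
      (T : (Finset.range (2 * n)).powersetCard ⌈ε * p * n⌉₊),
      {ω | DivergingRuns (⌊ε / p⌋₊ / 2) ⌈ε * p * n⌉₊ (planted ω.1) ω.2.1
        (trace ω.1 ω.2.1 ω.2.2) (enumeration S) (enumeration T)} with hE₂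
  -- Covering the whole space needs only subadditivity, hence no measurability of `G`.
  have hcover : Set.univ ⊆ G ∪ (E₁ ×ˢ Set.univ ∪ E₂) := by
    intro ω _
    by_contra hω
    simp only [Set.mem_union, not_or] at hω
    obtain ⟨h0, h1, h2⟩ := hω
    refine h0 fun M hM hcost => card_agreeing_ge hp0 hp23 hε23 hδ hδ' hw hn hM hcost ?_ ?_
    · simpa [hE₁] using h1
    · simpa [hE₂] using h2
  have h1 : (channelMeasure α p hp).real (E₁ ×ˢ Set.univ) ≤
      Real.exp (-(ε ^ 2 * p ^ 2 * n) / 2) := by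
    change ((opsMeasure p hp).prod (wordMeasure α)).real _ ≤ _
    rw [measureReal_prod_prod, probReal_univ, mul_one]
    refine ENNReal.toReal_le_of_le_ofReal (Real.exp_pos _).le ?_
    rw [← mul_pow]
    refine measure_predictable_sum_le p hp (fun t => measurable_isolationWeight p _ t)
      (fun t s z a h => isolationWeight_update p _ t s z a h)
      (fun t z => abs_isolationWeight_le hp0.le ?_ t z) n (by positivity)
    -- The weights are bounded by 2 because `2p(R + 1) ≤ 4ε + 2p ≤ 1`.
    have := Nat.floor_le (div_nonneg (by linarith : 0 ≤ 2 * ε) hp0.le)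
    rw [le_div_iff₀ hp0] at this
    push_cast
    linarith
  have h2 : (channelMeasure α p hp).real E₂ ≤ Real.exp (-(ε ^ 2 * p ^ 2 * n) / 2) := by
    refine le_trans ?_ (choose_mul_choose_mul_le hp0 hε (hδ.trans hδ') hε23 n)
    refine ENNReal.toReal_le_of_le_ofReal (by positivity) ?_
    refine (channelMeasure_iUnion_divergingRuns_le p hp _ _ _ _).trans ?_
    rw [ENNReal.ofReal_mul (by positivity), ENNReal.ofReal_mul (by positivity),
      ENNReal.ofReal_natCast, ENNReal.ofReal_natCast, ENNReal.ofReal_pow (by positivity)]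
    gcongr
    rw [one_div, ENNReal.ofReal_inv_of_pos (by norm_num)]
    refine ENNReal.inv_le_inv.2 ?_
    rw [show (2 : ℝ) = (2 : ℕ) by norm_num, ENNReal.ofReal_natCast]
    exact_mod_cast Fintype.one_lt_card
  have h3 := measureReal_mono (μ := channelMeasure α p hp) hcover
  have h4 := measureReal_union_le (μ := channelMeasure α p hp) G (E₁ ×ˢ Set.univ ∪ E₂)
  have h5 := measureReal_union_le (μ := channelMeasure α p hp) (E₁ ×ˢ Set.univ) E₂
  rw [probReal_univ] at h3
  have := Real.exp_pos (-(ε ^ 2 * p ^ 2 * n) / 2)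
  linarith
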